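/- Let $\sigma\in(0,2)$, $m\ge 1$, $X,Y,T>0$, $\Omega=(-X,X)\times(0,Y)$, and let $f\ge 0$ on $[-X,X]$. Put $L_\sigma v=\nabla\cdot(y^{1-\sigma}\nabla v)$, $\mu_\sigma=2^{\sigma-1}\Gamma(\sigma/2)/\Gamma(1-\sigma/2)$, $\nu_\sigma=\sigma\mu_\sigma$, and $\frac{\partial v}{\partial y^\sigma}(x,0)=\mu_\sigma\lim_{y\to0^+}y^{1-\sigma}\partial_y v(x,y)$. Let $w\ge0$, continuous on $\overline\Omega\times[0,T]$ and $C^2$ in $(x,y)\in\Omega$, be a classical solution of $$L_\sigma w=0 \text{ in } \Omega,\qquad \partial_t (w^{1/m})=\frac{\partial w}{\partial y^\sigma}\text{ at } y=0,\ |x|<X\qquad (0<t\le T),$$ with $w(x,0,0)=f(x)^m$ for $|x|\le X$, and $w=0$ on the sides $|x|=X$, $0<y\le Y$, and on $y=Y$. Write $u=w^{1/m}$ and assume that $w$ is regular in the following sense: $u(x,0,\cdot)$ is $C^2$ on $[0,T]$ with $\partial_t^2u(x,0,t)$ bounded uniformly in $x,t$; $\partial_x^2 w$ is bounded on $\Omega\times(0,T]$;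 and for some $R$, with $\varphi(s)=s^m$, $\varphi'(u(x,y,t))\le \varphi'(u(x,0,t))+R\,y^\sigma$ on $\Omega\times(0,T]$. For positive integers $I,K,J$ with $\Delta x:=2X/I=Y/K$ and $\Delta t:=T/J$ let $x_i=i\Delta x-X$, $y_k=k\Delta x$, $t_j=j\Delta t$ ($0\le i\le I$, $0\le k\le K$, $0\le j\le J$); a node is interior if $0<i<I$ and $0<k<K$. For every such grid let $L_\sigma^D$ be a linear operator on grid functions such that: - (order $a\in\mathbb R$) $|L^D_\sigma v_i^k-L_\sigma v(x_i,y_k)|\le C\Delta x^a$ at all interior nodes, with $C$ independent of the grid, for every $v\in C^\infty(\mathbb R^2)$ ($C$ may depend on $v$) and for $v=w(\cdot,\cdot,t)$ ($C$ independent of $t\in(0,T]$); - (discrete maximum principle) if $L_\sigma^DZ\ge0$ at all interior nodes, then $\max Z\le\max(0,\max Z|_{\text{boundary nodes}})$. Let $(W_j)_i^k$ solve the scheme: $L_\sigma^D(W_j)_i^k=0$ at interior nodes ($0\le j\le J$); $(W_j)_i^k=0$ if $i=0$, $i=I$ or $k=K$; and for $0<i<I$, $(W_0)_i^0=f(x_i)^m$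 and $$(W_j)_i^0=\Big[\nu_\sigma\frac{\Delta t}{\Delta x^\sigma}\big((W_{j-1})_i^1-(W_{j-1})_i^0\big)+[(W_{j-1})_i^0]^{1/m}\Big]^m\qquad(1\le j\le J).$$ Let $F_j=\max_{i,k}|w(x_i,y_k,t_j)-(W_j)_i^k|$ and $C(m,f)=\big[m\,\|f\|_{L^\infty(-X,X)}^{m-1}\,\nu_\sigma\big]^{-1}$ ($=+\infty$ if $f=0$ and $m>1$). Let $D>0$ be a constant and assume that either - $\sigma\in(0,1]$, $a\ge2\sigma$ and $D\Delta x^{a/2}\le\Delta t\le C(m,f)\Delta x^\sigma$; or - $\sigma\in(1,2)$, $a\ge2$ and $D\Delta x^{a+\sigma-2}\le\Delta t\le C(m,f)\Delta x^\sigma$. Then $F_J=O(\Delta t+\Delta x^{2-\sigma})$: there is a constant $C>0$, independent of the grid $(I,K,J)$ and of the numerical solution $W$, with $F_J\le C(\Delta t+\Delta x^{2-\sigma})$ for all such grids. -/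

import Mathlib

open Set Filter Topology
open scoped ContDiff

namespace FracPME

noncomputable section

/-- `μ_σ = 2^(σ-1) Γ(σ/2) / Γ(1-σ/2)`. -/
def mu (σ : ℝ) : ℝ := 2 ^ (σ - 1) * Real.Gamma (σ / 2) / Real.Gamma (1 - σ / 2)

/-- `ν_σ = σ μ_σ`. -/
def nu (σ : ℝ) : ℝ := σ * mu σ

/-- The extension operator `L_σ v = div (y^(1-σ) ∇v)` at the point `(x, y)`. -/
def Lsigma (σ : ℝ) (v : ℝ → ℝ → ℝ) (x y : ℝ) : ℝ :=
  deriv (fun x' => y ^ (1 - σ) * deriv (fun x'' => v x'' y) x') x +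
    deriv (fun y' => y' ^ (1 - σ) * deriv (fun y'' => v x y'') y') y

/-- The trace `u(x, t) = w(x, 0, t)^(1/m)` on the base `y = 0`. -/
def trace (m : ℝ) (w : ℝ → ℝ → ℝ → ℝ) (x t : ℝ) : ℝ := (w x 0 t) ^ (1 / m)

/-- `w(x, y, t)` is a nonnegative classical solution of the extension problem in
`Ω = (-X, X) × (0, Y)`, `0 < t ≤ T`:
`L_σ w = 0` in `Ω`, `∂_t w^(1/m) = ∂w/∂y^σ` on the base, `w(x, 0, 0) = f(x)^m`,
and `w = 0` on the rest `Γ_h` of the boundary. -/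
structure IsClassicalSolution (σ m X Y T : ℝ) (f : ℝ → ℝ) (w : ℝ → ℝ → ℝ → ℝ) : Prop where
  continuousOn : ContinuousOn (fun p : ℝ × ℝ × ℝ => w p.1 p.2.1 p.2.2)
    (Icc (-X) X ×ˢ Icc 0 Y ×ˢ Icc 0 T)
  nonneg : ∀ x ∈ Icc (-X) X, ∀ y ∈ Icc 0 Y, ∀ t ∈ Icc 0 T, 0 ≤ w x y t
  contDiffOn : ∀ t ∈ Ioc 0 T,
    ContDiffOn ℝ 2 (fun p : ℝ × ℝ => w p.1 p.2 t) (Ioo (-X) X ×ˢ Ioo 0 Y)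
  extension_eq : ∀ x ∈ Ioo (-X) X, ∀ y ∈ Ioo 0 Y, ∀ t ∈ Ioc 0 T,
    Lsigma σ (fun x' y' => w x' y' t) x y = 0
  differentiable_trace : ∀ x ∈ Ioo (-X) X, ∀ t ∈ Ioc 0 T,
    DifferentiableWithinAt ℝ (trace m w x) (Icc 0 T) t
  base_eq : ∀ x ∈ Ioo (-X) X, ∀ t ∈ Ioc 0 T,
    Tendsto (fun y => mu σ * (y ^ (1 - σ) * deriv (fun y' => w x y' t) y)) (𝓝[>] 0)
      (𝓝 (derivWithin (trace m w x) (Icc 0 T) t))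
  initial : ∀ x ∈ Icc (-X) X, w x 0 0 = f x ^ m
  lateral : ∀ y ∈ Ioc 0 Y, ∀ t ∈ Icc 0 T, w (-X) y t = 0 ∧ w X y t = 0
  top : ∀ x ∈ Icc (-X) X, ∀ t ∈ Icc 0 T, w x Y t = 0

/-- The regularity of the exact solution: `u` is `C²` in `t` on the base, `w = u^m` is `C²` in `x`
(with bounds on the second derivatives that are uniform up to the boundary), and
`φ'(u) = m u^(m-1)`, where `φ(u) = u^m` and `u = w^(1/m)`, exceeds its value on the base by at most
a multiple of `y^σ`. -/
structure IsRegular (σ m X Y T : ℝ) (w : ℝ → ℝ → ℝ → ℝ) : Prop where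
  contDiffOn_time : ∀ x ∈ Ioo (-X) X, ContDiffOn ℝ 2 (trace m w x) (Icc 0 T)
  bound_time : ∃ B : ℝ, ∀ x ∈ Ioo (-X) X, ∀ t ∈ Icc 0 T,
    |iteratedDerivWithin 2 (trace m w x) (Icc 0 T) t| ≤ B
  bound_space : ∃ B : ℝ, ∀ x ∈ Ioo (-X) X, ∀ y ∈ Ioo 0 Y, ∀ t ∈ Ioc 0 T,
    |iteratedDeriv 2 (fun x' => w x' y t) x| ≤ B
  bound_pressure : ∃ R : ℝ, ∀ x ∈ Ioo (-X) X, ∀ y ∈ Ioo 0 Y, ∀ t ∈ Ioc 0 T,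
    m * ((w x y t) ^ (1 / m)) ^ (m - 1) ≤ m * ((w x 0 t) ^ (1 / m)) ^ (m - 1) + R * y ^ σ

/-- Real functions on the nodes `(i, k)`, `0 ≤ i ≤ I`, `0 ≤ k ≤ K`. -/
abbrev Grid (I K : ℕ) : Type := Fin (I + 1) → Fin (K + 1) → ℝ

/-- Space step `Δx = 2X/I`. -/
def dx (X : ℝ) (I : ℕ) : ℝ := 2 * X / I

/-- Time step `Δt = T/J`. -/
def dt (T : ℝ) (J : ℕ) : ℝ := T / J

/-- The admissible numbers of steps: all positive, and `Δy = Y/K` equals `Δx`. -/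
def IsMesh (X Y : ℝ) (I K : ℕ) : Prop := 0 < I ∧ 0 < K ∧ dx X I = Y / K

/-- The values `v(x_i, y_k)`, with `x_i = iΔx - X` and `y_k = kΔx`. -/
def sample (X : ℝ) (I K : ℕ) (v : ℝ → ℝ → ℝ) : Grid I K :=
  fun i k => v (i * dx X I - X) (k * dx X I)

/-- Interior nodes: `0 < i < I`, `0 < k < K`. -/
def IsInterior {I K : ℕ} (i : Fin (I + 1)) (k : Fin (K + 1)) : Prop :=
  0 < i.val ∧ i.val < I ∧ 0 < k.val ∧ k.val < K

/-- Nodes with `i = 0`, `i = I` or `k = K`. -/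
def IsLateral {I K : ℕ} (i : Fin (I + 1)) (k : Fin (K + 1)) : Prop :=
  i.val = 0 ∨ i.val = I ∨ k.val = K

/-- A linear finite difference operator on every grid; only its values at interior nodes
are used. -/
abbrev Discretization : Type := (I K : ℕ) → Grid I K →ₗ[ℝ] Grid I K

/-- `L` approximates `L_σ` to order `a`, uniformly on the family `V`:
`max_{i,k} |L v_i^k - L_σ v(x_i, y_k)| ≤ C Δx^a` with the same `C` for all `v ∈ V`
and all meshes. -/
def HasOrderOn (L : Discretization) (σ X Y a : ℝ) (V : Set (ℝ → ℝ → ℝ)) : Prop :=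
  ∃ C : ℝ, ∀ I K : ℕ, IsMesh X Y I K → ∀ v ∈ V, ∀ (i : Fin (I + 1)) (k : Fin (K + 1)),
    IsInterior i k →
      |L I K (sample X I K v) i k - Lsigma σ v (i * dx X I - X) (k * dx X I)| ≤ C * dx X I ^ a

/-- The discrete maximum principle: if `L Z ≥ 0` at the interior nodes, then
`max Z ≤ max (0, max of Z over the boundary nodes)`. -/
def SatisfiesMaxPrinciple (L : Discretization) (X Y : ℝ) : Prop :=
  ∀ I K : ℕ, IsMesh X Y I K → ∀ Z : Grid I K,
    (∀ i k, IsInterior i k → 0 ≤ L I K Z i k) →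
    ∀ c : ℝ, 0 ≤ c → (∀ i k, ¬ IsInterior i k → Z i k ≤ c) → ∀ i k, Z i k ≤ c

/-- `(W_j)_i^k`, `0 ≤ j ≤ J`, solves the numerical scheme. -/
structure IsNumericalSolution (L : Discretization) (σ m X T : ℝ) (f : ℝ → ℝ) (I K J : ℕ)
    (W : ℕ → Grid I K) : Prop where
  interior : ∀ j ≤ J, ∀ i k, IsInterior i k → L I K (W j) i k = 0
  initial : ∀ i : Fin (I + 1), 0 < i.val → i.val < I → W 0 i 0 = f (i * dx X I - X) ^ m
  base : ∀ j < J, ∀ i : Fin (I + 1), 0 < i.val → i.val < I →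
    W (j + 1) i 0 =
      (nu σ * (dt T J / dx X I ^ σ) * (W j i 1 - W j i 0) + W j i 0 ^ (1 / m)) ^ m
  lateral : ∀ j ≤ J, ∀ i k, IsLateral i k → W j i k = 0

/-- `F_j = max_{i,k} |w(x_i, y_k, t_j) - (W_j)_i^k|`. -/
def errorF (X T : ℝ) (I K J : ℕ) (w : ℝ → ℝ → ℝ → ℝ) (W : ℕ → Grid I K) (j : ℕ) : ℝ :=
  (Finset.univ : Finset (Fin (I + 1) × Fin (K + 1))).sup' Finset.univ_nonempty
    (fun p => |sample X I K (fun x y => w x y (j * dt T J)) p.1 p.2 - W j p.1 p.2|)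

/-- `‖f‖_∞` on `[-X, X]`, for nonnegative `f`. -/
def supNorm (X : ℝ) (f : ℝ → ℝ) : ℝ := sSup (f '' Icc (-X) X)

/-- The step restriction `Δt ≤ C(m,f) Δx^σ`, where `C(m,f) = (m ‖f‖_∞^(m-1) ν_σ)⁻¹`, in a form that
also reads correctly (as no restriction) if `f = 0` and `m > 1`. -/
def StepRestriction (σ m X T : ℝ) (f : ℝ → ℝ) (I J : ℕ) : Prop :=
  m * supNorm X f ^ (m - 1) * nu σ * dt T J ≤ dx X I ^ σ

end

end FracPME

/-! The error is measured in `w = u ^ m`, the variable to which the discrete maximum principle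
applies. With `l = ν_σ Δt / Δx^σ`, the update `U + l (W₁ - U ^ m)` is nondecreasing in `W₁` and,
under the step restriction, in `U ∈ [0, M]`, `M = ‖f‖_∞`. Hence an error can be carried through a
time step by comparison. Maximum principles keep both the exact and the numerical `u` in `[0, M]`
(`trace_le_supNorm`, `IsNumericalSolution.mem_Icc`).

The delicate point is the growth of the error. A step shifts `u` by about `b = Δt ∂_t u`, and a
positive shift enlarges increments of the convex function `s ^ m`, by an uncontrolled factor where
`u` is near zero. For `m > 1` the bound on `φ'(u)` gives `∂_t u ≤ κ u` (`exists_deriv_le`). The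
shift is then dominated by multiplication by at most `1 + κ Δt`, so increments grow by at most `(1 +
κ Δt) ^ m ≤ exp (κ m Δt)` (`clampPow_shift_sub_le`, `step_error`). For `m = 1` there is no such
growth.

Each step also adds defects. Taylor expansion in time costs `O(Δt²)`. Integrating `(y^(1-σ) w_y)_y =
-y^(1-σ) w_xx` twice from the base shows that the flux quotient costs `O(Δt Δx^(2-σ))`
(`exists_flux_bound`). A barrier and the discrete maximum principle bound the error at all nodes by
the base error plus `O(Δx^a)` (`exists_discrete_bound`), and the lower bound on `Δt` makes this
`O(Δt (Δt + Δx^(2-σ)))`. Summing over `T / Δt` steps with Gronwall's inequality gives the rate. The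
barrier needs a fine mesh; on coarse meshes boundedness suffices. -/

namespace FracPME

/-! ### Inequalities for the power `s ^ m` and its cut-off. -/

/-- The increments of `s ↦ s ^ m` are nondecreasing. -/
lemma rpow_increment_mono {m x y d : ℝ} (hm : 1 ≤ m) (hx : 0 ≤ x) (hxy : x ≤ y) (hd : 0 ≤ d) :
    (x + d) ^ m - x ^ m ≤ (y + d) ^ m - y ^ m := by
  have hmono : MonotoneOn (fun s : ℝ => (s + d) ^ m - s ^ m) (Ici 0) := by
    have hder : ∀ s ∈ Ioi (0 : ℝ), HasDerivAt (fun s : ℝ => (s + d) ^ m - s ^ m)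
        (1 * m * (s + d) ^ (m - 1) - m * s ^ (m - 1)) s := fun s hs =>
      (((hasDerivAt_id s).add_const d).rpow_const (Or.inr hm)).sub
        (Real.hasDerivAt_rpow_const (Or.inr hm))
    refine monotoneOn_of_deriv_nonneg (convex_Ici 0) ?_ ?_ ?_
    · have h0 : (0 : ℝ) ≤ m := by linarith
      exact (((continuous_id.add continuous_const).rpow_const fun _ => Or.inr h0).sub
        (continuous_id.rpow_const fun _ => Or.inr h0)).continuousOn
    · intro s hs
      rw [interior_Ici] at hs
      exact (hder s hs).differentiableAt.differentiableWithinAt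
    · intro s hs
      rw [interior_Ici] at hs
      rw [(hder s hs).deriv]
      have hs' : (0 : ℝ) < s := hs
      have := Real.rpow_le_rpow hs'.le (by linarith : s ≤ s + d) (by linarith : 0 ≤ m - 1)
      nlinarith
  exact hmono hx (hx.trans hxy) hxy

/-- The tangent line inequality for `s ↦ s ^ m`. -/
lemma rpow_sub_rpow_le {m x y : ℝ} (hm : 1 ≤ m) (hx : 0 ≤ x) (hxy : x ≤ y) :
    y ^ m - x ^ m ≤ m * y ^ (m - 1) * (y - x) := by
  rcases (hx.trans hxy).eq_or_lt with hy | hy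
  · have : x = y := le_antisymm hxy (hy ▸ hx)
    simp [this]
  · have h1 : -1 ≤ (x - y) / y := by
      rw [le_div_iff₀ hy]; linarith
    -- Bernoulli's inequality at the ratio `x / y`, multiplied by `y ^ m` below.
    have h2 := one_add_mul_self_le_rpow_one_add h1 hm
    have h3 : 1 + (x - y) / y = x / y := by field_simp; ring
    rw [h3, Real.div_rpow hx hy.le, le_div_iff₀ (Real.rpow_pos_of_pos hy m)] at h2
    have h4 : y ^ m = y ^ (m - 1) * y := by
      rw [← Real.rpow_add_one hy.ne']; ring_nf
    have h5 : (1 + m * ((x - y) / y)) * y ^ m = y ^ m + m * y ^ (m - 1) * (x - y) := by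
      rw [h4]; field_simp
    linarith

lemma rpow_sub_rpow_le_of_le {m x y M : ℝ} (hm : 1 ≤ m) (hx : 0 ≤ x) (hxy : x ≤ y) (hy : y ≤ M) :
    y ^ m - x ^ m ≤ m * M ^ (m - 1) * (y - x) := by
  refine (rpow_sub_rpow_le hm hx hxy).trans ?_
  have := Real.rpow_le_rpow (hx.trans hxy) hy (by linarith : 0 ≤ m - 1)
  have h2 : 0 ≤ y - x := by linarith
  gcongr

/-- Under the step restriction, `s ↦ s - l s ^ m` is nondecreasing on `[0, M]`. -/
lemma sub_mul_rpow_mono {m x y M l : ℝ} (hm : 1 ≤ m) (hx : 0 ≤ x) (hxy : x ≤ y) (hy : y ≤ M)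
    (hl : 0 ≤ l) (hlM : l * (m * M ^ (m - 1)) ≤ 1) :
    x - l * x ^ m ≤ y - l * y ^ m := by
  have h1 := mul_le_mul_of_nonneg_left (rpow_sub_rpow_le_of_le hm hx hxy hy) hl
  have h2 := mul_le_mul_of_nonneg_right hlM (by linarith : 0 ≤ y - x)
  nlinarith

/-- `s ^ m`, with `s` cut off to `[0, M]`. -/
noncomputable def clampPow (m M s : ℝ) : ℝ := (max 0 (min s M)) ^ m

lemma clampPow_of_mem {m M s : ℝ} (h0 : 0 ≤ s) (h1 : s ≤ M) : clampPow m M s = s ^ m := by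
  simp [clampPow, h0, h1]

lemma clampPow_mono {m M x y : ℝ} (hm : 1 ≤ m) (hxy : x ≤ y) :
    clampPow m M x ≤ clampPow m M y :=
  Real.rpow_le_rpow (le_max_left _ _) (max_le_max le_rfl (min_le_min hxy le_rfl)) (by linarith)

/-- Cutting off to `[0, M]` is nonexpansive, so the Lipschitz constant of `s ^ m` on `[0, M]` serves
for all real arguments, even those that a perturbation has moved out of the interval. -/
lemma clampPow_sub_le {m M x y : ℝ} (hm : 1 ≤ m) (hM : 0 ≤ M) (hxy : x ≤ y) :
    clampPow m M y - clampPow m M x ≤ m * M ^ (m - 1) * (y - x) := by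
  have h1 : max 0 (min x M) ≤ max 0 (min y M) := max_le_max le_rfl (min_le_min hxy le_rfl)
  refine (rpow_sub_rpow_le_of_le hm (le_max_left _ _) h1
    (max_le hM (min_le_right _ _))).trans ?_
  have h2 : max 0 (min y M) - max 0 (min x M) ≤ y - x := by grind
  have : 0 ≤ M ^ (m - 1) := Real.rpow_nonneg hM _
  gcongr

lemma clampPow_add_le {m M x d : ℝ} (hm : 1 ≤ m) (hM : 0 ≤ M) (hd : 0 ≤ d) :
    clampPow m M (x + d) ≤ clampPow m M x + m * M ^ (m - 1) * d := by
  have := clampPow_sub_le hm hM (by linarith : x ≤ x + d)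
  rw [add_sub_cancel_left] at this
  linarith

/-- The cut-off at `M` only shortens increments, so convexity arguments can ignore it. -/
lemma clampPow_sub_le_posPart {m M x y : ℝ} (hm : 1 ≤ m) (hxy : x ≤ y) :
    clampPow m M y - clampPow m M x ≤ (max 0 y) ^ m - (max 0 x) ^ m := by
  have hm0 : 0 ≤ m := by linarith
  rcases le_total y M with hy | hy
  · simp [clampPow, hy, hxy.trans hy]
  rcases le_total x M with hx | hx
  · have : clampPow m M x = (max 0 x) ^ m := by simp [clampPow, hx]
    rw [this]
    have h1 : clampPow m M y ≤ (max 0 y) ^ m := by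
      refine Real.rpow_le_rpow (le_max_left _ _) (max_le_max le_rfl (min_le_left _ _)) hm0
    linarith
  · have : clampPow m M y = clampPow m M x := by simp [clampPow, hx, hy]
    rw [this, sub_self, sub_nonneg]
    exact Real.rpow_le_rpow (le_max_left _ _) (max_le_max le_rfl hxy) hm0

/-- A shift by `b` changes a difference of `m`-th powers at most by the factor `(1 + κ) ^ m`, if
`b ≤ κ u` at one of the two points. -/
lemma clampPow_shift_sub_le {m M x y u b κ : ℝ} (hm : 1 ≤ m) (hx : 0 ≤ x)
    (hxy : x ≤ y) (hu : u = x ∨ u = y) (hκ : 0 ≤ κ) (hb : m = 1 ∨ b ≤ κ * u) :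
    clampPow m M (y + b) - clampPow m M (x + b) ≤ (1 + κ) ^ m * (y ^ m - x ^ m) := by
  have hm0 : 0 ≤ m := by linarith
  have hκm : 1 ≤ (1 + κ) ^ m := Real.one_le_rpow (by linarith) hm0
  have hdiff : 0 ≤ y ^ m - x ^ m := sub_nonneg.2 (Real.rpow_le_rpow hx hxy hm0)
  refine (clampPow_sub_le_posPart hm (by linarith : x + b ≤ y + b)).trans ?_
  rcases eq_or_ne m 1 with rfl | hm1
  · simp only [Real.rpow_one]
    simp only [Real.rpow_one] at hdiff
    have : max 0 (y + b) - max 0 (x + b) ≤ y - x := by grind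
    nlinarith
  have hb : b ≤ κ * u := hb.resolve_left hm1
  rcases le_or_gt b 0 with hb0 | hb0
  · refine le_trans ?_ (le_mul_of_one_le_left hdiff hκm)
    rcases le_total 0 (x + b) with h | h
    · rw [max_eq_right h, max_eq_right (by linarith)]
      have := rpow_increment_mono hm h (by linarith : x + b ≤ x) (by linarith : 0 ≤ y - x)
      rwa [show x + b + (y - x) = y + b by ring, show x + (y - x) = y by ring] at this
    · rw [max_eq_left h, Real.zero_rpow (by linarith), sub_zero]
      -- The lower point is cut off at zero; the increment over `[0, y - x]` is at most the one over
      -- `[x, y]`.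
      have h1 := rpow_increment_mono hm le_rfl hx (by linarith : 0 ≤ y - x)
      rw [zero_add, Real.zero_rpow (by linarith), sub_zero, show x + (y - x) = y by ring] at h1
      refine le_trans (Real.rpow_le_rpow (le_max_left _ _) ?_ hm0) h1
      exact max_le (by linarith) (by linarith)
  · have hu0 : 0 < u := by
      have : 0 ≤ u := by rcases hu with rfl | rfl <;> linarith
      rcases this.eq_or_lt with h | h
      · rw [← h] at hb; linarith
      · exact h
    -- With this factor `k * u = u + b`. Whichever endpoint `u` is, dilation by `k` raises `y` at
    -- least, and `x` at most, as much as the shift by `b` does.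
    set k := 1 + b / u with hk
    have hbu : 0 < b / u := by positivity
    have hk0 : 0 ≤ k := by positivity
    have hkκ : k ≤ 1 + κ := by
      have : b / u ≤ κ := by rwa [div_le_iff₀ hu0]
      linarith
    have hbu' : b / u * u = b := by field_simp
    have hy1 : y + b ≤ k * y := by
      rcases hu with rfl | rfl <;> nlinarith
    have hx1 : k * x ≤ x + b := by
      rcases hu with rfl | rfl <;> nlinarith
    rw [max_eq_right (by linarith), max_eq_right (by linarith)]
    have e1 := Real.rpow_le_rpow (by linarith : 0 ≤ y + b) hy1 hm0
    have e2 := Real.rpow_le_rpow (by positivity : 0 ≤ k * x) hx1 hm0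
    rw [Real.mul_rpow hk0 (hx.trans hxy)] at e1
    rw [Real.mul_rpow hk0 hx] at e2
    have e3 : k ^ m ≤ (1 + κ) ^ m := Real.rpow_le_rpow hk0 hkκ hm0
    calc (y + b) ^ m - (x + b) ^ m ≤ k ^ m * (y ^ m - x ^ m) := by linarith
      _ ≤ _ := by gcongr

lemma rpow_rpow_one_div {m s : ℝ} (hm : 1 ≤ m) (hs : 0 ≤ s) : (s ^ (1 / m)) ^ m = s := by
  rw [one_div]; exact Real.rpow_inv_rpow hs (by linarith)

lemma rpow_one_div_rpow {m s : ℝ} (hm : 1 ≤ m) (hs : 0 ≤ s) : (s ^ m) ^ (1 / m) = s := by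
  rw [one_div]; exact Real.rpow_rpow_inv hs (by linarith)

/-! ### One time step of the scheme, and the accumulation of errors. -/

/-- One step of the explicit scheme keeps the values in `[0, M]`. -/
lemma step_mem {m M l U W₁ : ℝ} (hm : 1 ≤ m) (hl : 0 ≤ l)
    (hlM : l * (m * M ^ (m - 1)) ≤ 1) (hU : U ∈ Icc 0 M) (hW : W₁ ∈ Icc 0 (M ^ m)) :
    U + l * (W₁ - U ^ m) ∈ Icc 0 M := by
  have h1 := sub_mul_rpow_mono hm le_rfl hU.1 hU.2 hl hlM
  have h2 := sub_mul_rpow_mono hm hU.1 hU.2 le_rfl hl hlM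
  rw [Real.zero_rpow (by linarith)] at h1
  have h3 := mul_nonneg hl hW.1
  have h4 := mul_le_mul_of_nonneg_left hW.2 hl
  constructor <;> nlinarith

/-- Propagation of the error in one step of the explicit scheme, measured in `u ^ m`. -/
lemma step_error {m M l U W₁ u w₁ u' b κ ε r s : ℝ} (hm : 1 ≤ m) (hl : 0 ≤ l)
    (hlM : l * (m * M ^ (m - 1)) ≤ 1) (hU : U ∈ Icc 0 M) (hW : W₁ ∈ Icc 0 (M ^ m))
    (hu : u ∈ Icc 0 M) (hu' : u' ∈ Icc 0 M) (hκ : 0 ≤ κ) (hb : m = 1 ∨ b ≤ κ * u)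
    (hε : |u ^ m - U ^ m| ≤ ε) (hε₁ : |w₁ - W₁| ≤ ε) (hr : |u' - (u + b)| ≤ r)
    (hs : |l * (w₁ - u ^ m) - b| ≤ s) :
    |u' ^ m - (U + l * (W₁ - U ^ m)) ^ m| ≤ (1 + κ) ^ m * ε + m * M ^ (m - 1) * (r + s) := by
  have hm0 : 0 ≤ m := by linarith
  have hm1 : 0 ≤ 1 / m := by positivity
  have hM : 0 ≤ M := hu.1.trans hu.2
  have hε0 : 0 ≤ ε := (abs_nonneg _).trans hε
  have hr0 : 0 ≤ r := (abs_nonneg _).trans hr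
  have hs0 : 0 ≤ s := (abs_nonneg _).trans hs
  have hκm : 1 ≤ (1 + κ) ^ m := Real.one_le_rpow (by linarith) hm0
  have hU' := step_mem hm hl hlM hU hW
  set U' := U + l * (W₁ - U ^ m) with hUdef
  set Λ := m * M ^ (m - 1) with hΛ
  have hΛ0 : 0 ≤ Λ := mul_nonneg hm0 (Real.rpow_nonneg hM _)
  have hum : 0 ≤ u ^ m := Real.rpow_nonneg hu.1 _
  have hUm : 0 ≤ U ^ m := Real.rpow_nonneg hU.1 _
  -- Both new values lie in `[0, M]`, but the intermediate comparison values, such as `Ψ + b`, need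
  -- not.
  rw [← clampPow_of_mem (m := m) hu'.1 hu'.2, ← clampPow_of_mem (m := m) hU'.1 hU'.2]
  rw [abs_le] at hε hε₁ hr hs ⊢
  constructor
  -- The largest value in `[0, M]` that `U` can have, given the error bound; by monotonicity the
  -- worst case is `U = Ψ`, `W₁ = w₁ + ε`.
  · set Ψ := min ((u ^ m + ε) ^ (1 / m)) M with hΨ
    have hΨM : Ψ ≤ M := min_le_right _ _
    have huΨ : u ≤ Ψ := by
      refine le_min ?_ hu.2
      calc u = (u ^ m) ^ (1 / m) := (rpow_one_div_rpow hm hu.1).symm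
        _ ≤ _ := Real.rpow_le_rpow hum (by linarith) hm1
    have hUΨ : U ≤ Ψ := by
      refine le_min ?_ hU.2
      calc U = (U ^ m) ^ (1 / m) := (rpow_one_div_rpow hm hU.1).symm
        _ ≤ _ := Real.rpow_le_rpow hUm (by linarith) hm1
    have hΨm : Ψ ^ m ≤ u ^ m + ε := by
      calc Ψ ^ m ≤ ((u ^ m + ε) ^ (1 / m)) ^ m :=
            Real.rpow_le_rpow (hu.1.trans huΨ) (min_le_left _ _) hm0
        _ = _ := rpow_rpow_one_div hm (by linarith)
    -- The part of `ε` lost to the cap at `M`. It enters the update as `l * d` and, by the step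
    -- restriction, costs at most `d` after taking powers; so the two parts of `ε` add up again.
    set d := ε - (Ψ ^ m - u ^ m) with hd
    have hd0 : 0 ≤ d := by linarith
    have h1 : U' ≤ Ψ + b + (s + l * d) := by
      have e1 := sub_mul_rpow_mono hm hU.1 hUΨ hΨM hl hlM
      have e2 := mul_le_mul_of_nonneg_left (by linarith : W₁ ≤ w₁ + ε) hl
      have e3 : l * (w₁ + ε) = l * (w₁ - u ^ m) + l * d + l * Ψ ^ m := by rw [hd]; ring
      have e4 : U' = (U - l * U ^ m) + l * W₁ := by rw [hUdef]; ring
      linarith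
    have h2 : clampPow m M U' ≤ clampPow m M (Ψ + b) + Λ * (s + l * d) :=
      (clampPow_mono hm h1).trans (clampPow_add_le hm hM (by positivity))
    have h3 := clampPow_shift_sub_le (M := M) hm hu.1 huΨ (Or.inl rfl) hκ hb
    have h4 : clampPow m M (u + b) ≤ clampPow m M u' + Λ * r := by
      refine (clampPow_mono hm (by linarith : u + b ≤ u' + r)).trans (clampPow_add_le hm hM hr0)
    have h5 : Λ * (l * d) ≤ d := by nlinarith
    have h6 : d ≤ (1 + κ) ^ m * d := le_mul_of_one_le_left hd0 hκm
    have h7 : (1 + κ) ^ m * ε = (1 + κ) ^ m * d + (1 + κ) ^ m * (Ψ ^ m - u ^ m) := by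
      rw [hd]; ring
    linarith
  -- The mirror image: the smallest admissible value of `U`, with the cap now at zero and `u` as the
  -- upper point of the shifted increment.
  · set ψ := (max 0 (u ^ m - ε)) ^ (1 / m) with hψ
    have hmax : 0 ≤ max 0 (u ^ m - ε) := le_max_left _ _
    have hψ0 : 0 ≤ ψ := Real.rpow_nonneg hmax _
    have huψ : ψ ≤ u := by
      calc ψ ≤ (u ^ m) ^ (1 / m) := Real.rpow_le_rpow hmax (max_le hum (by linarith)) hm1
        _ = u := rpow_one_div_rpow hm hu.1
    have hUψ : ψ ≤ U := by
      calc ψ ≤ (U ^ m) ^ (1 / m) := Real.rpow_le_rpow hmax (max_le hUm (by linarith)) hm1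
        _ = U := rpow_one_div_rpow hm hU.1
    have hψm : u ^ m - ε ≤ ψ ^ m := by
      rw [hψ, rpow_rpow_one_div hm hmax]
      exact le_max_right _ _
    set d := ε - (u ^ m - ψ ^ m) with hd
    have hd0 : 0 ≤ d := by linarith
    have h1 : ψ + b ≤ U' + (s + l * d) := by
      have e1 := sub_mul_rpow_mono hm hψ0 hUψ hU.2 hl hlM
      have e2 := mul_le_mul_of_nonneg_left (by linarith : w₁ - ε ≤ W₁) hl
      have e3 : l * (w₁ - ε) = l * (w₁ - u ^ m) - l * d + l * ψ ^ m := by rw [hd]; ring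
      have e4 : U' = (U - l * U ^ m) + l * W₁ := by rw [hUdef]; ring
      linarith
    have h2 : clampPow m M (ψ + b) ≤ clampPow m M U' + Λ * (s + l * d) :=
      (clampPow_mono hm h1).trans (clampPow_add_le hm hM (by positivity))
    have h3 := clampPow_shift_sub_le (M := M) hm hψ0 huψ (Or.inr rfl) hκ hb
    have h4 : clampPow m M u' ≤ clampPow m M (u + b) + Λ * r := by
      refine (clampPow_mono hm (by linarith : u' ≤ u + b + r)).trans (clampPow_add_le hm hM hr0)
    have h5 : Λ * (l * d) ≤ d := by nlinarith
    have h6 : d ≤ (1 + κ) ^ m * d := le_mul_of_one_le_left hd0 hκm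
    have h7 : (1 + κ) ^ m * ε = (1 + κ) ^ m * d + (1 + κ) ^ m * (u ^ m - ψ ^ m) := by
      rw [hd]; ring
    linarith

/-- Discrete Gronwall inequality. -/
lemma le_of_recursion {F : ℕ → ℝ} {ρ β A : ℝ} {J : ℕ} (hρ : 1 ≤ ρ) (hβ : 0 ≤ β)
    (h0 : F 0 ≤ A) (hF : ∀ j < J, F (j + 1) ≤ ρ * F j + β) :
    ∀ j ≤ J, F j ≤ ρ ^ j * (A + j * β) := by
  intro j
  induction j with
  | zero => intro _; simpa using h0
  | succ j ih =>
    intro hj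
    have h1 := ih (by omega)
    have h2 := hF j (by omega)
    have h3 : 1 ≤ ρ ^ (j + 1) := one_le_pow₀ hρ
    calc F (j + 1) ≤ ρ * (ρ ^ j * (A + j * β)) + β := by
          refine h2.trans ?_
          gcongr
      _ ≤ ρ * (ρ ^ j * (A + j * β)) + ρ ^ (j + 1) * β := by
          gcongr
          exact le_mul_of_one_le_left hβ h3
      _ = _ := by push_cast; ring

/-! ### One-variable calculus: weighted derivatives, the pressure bound, Taylor expansion. -/

lemma mu_pos {σ : ℝ} (h0 : 0 < σ) (h2 : σ < 2) : 0 < mu σ := by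
  have h3 : 0 < Real.Gamma (σ / 2) := Real.Gamma_pos_of_pos (by linarith)
  have h4 : 0 < Real.Gamma (1 - σ / 2) := Real.Gamma_pos_of_pos (by linarith)
  unfold mu
  positivity

lemma nu_pos {σ : ℝ} (h0 : 0 < σ) (h2 : σ < 2) : 0 < nu σ := mul_pos h0 (mu_pos h0 h2)

/-- The second derivative test at a local maximum, for the operator `g ↦ (ρ g')'`. -/
lemma deriv_mul_deriv_nonpos_of_isLocalMax {g ρ : ℝ → ℝ} {y : ℝ} (hρ : ∀ᶠ z in 𝓝 y, 0 < ρ z)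
    (hg : ContinuousAt g y) (hmax : IsLocalMax g y) :
    deriv (fun z => ρ z * deriv g z) y ≤ 0 := by
  by_contra! hpos
  have hzero : ρ y * deriv g y = 0 := by rw [hmax.deriv_eq_zero, mul_zero]
  -- The flux `ρ g'` vanishes at `y` and would be positive just to the right, so `g` would increase
  -- there.
  have hsign := eventually_nhdsWithin_sign_eq_of_deriv_pos hpos hzero
  obtain ⟨d, hd, hball⟩ := Metric.eventually_nhds_iff.1 (hsign.and (hρ.and hmax))
  have hder : ∀ z ∈ Ioo y (y + d), 0 < deriv g z := by
    intro z hz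
    have hdist : dist z y < d := by
      rw [Real.dist_eq, abs_of_pos (by linarith [hz.1])]; linarith [hz.2]
    obtain ⟨h3, h2, -⟩ := hball hdist
    rw [sign_pos (by linarith [hz.1] : 0 < z - y), sign_eq_one_iff] at h3
    exact (pos_iff_pos_of_mul_pos h3).1 h2
  have hmono : StrictMonoOn g (Icc y (y + d / 2)) := by
    refine strictMonoOn_of_deriv_pos (convex_Icc _ _) ?_ ?_
    · intro z hz
      rcases hz.1.eq_or_lt with h | h
      · rw [← h]; exact hg.continuousWithinAt
      -- A nonzero `deriv` is not the default value, so differentiability comes for free.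
      · exact (differentiableAt_of_deriv_ne_zero
          (hder z ⟨h, by linarith [hz.2]⟩).ne').continuousAt.continuousWithinAt
    · intro z hz
      rw [interior_Icc] at hz
      exact hder z ⟨hz.1, by linarith [hz.2]⟩
  have hlt := hmono (left_mem_Icc.2 (by linarith)) (right_mem_Icc.2 (by linarith))
    (by linarith : y < y + d / 2)
  have hle : g (y + d / 2) ≤ g y := by
    refine (hball ?_).2.2
    rw [Real.dist_eq, add_sub_cancel_left, abs_of_pos (by linarith)]; linarith
  linarith

/-- If the weighted derivative `z ^ (1 - σ) g'(z)` has the limit `q` at `0` and its derivative is at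
most `B z ^ (1 - σ)`, then `g h - g 0 ≤ q h ^ σ / σ + O(h ^ 2)`. -/
lemma sub_le_of_weighted_deriv {σ B q h : ℝ} {g : ℝ → ℝ} (h0 : 0 < σ) (h2 : σ < 2) (hh : 0 < h)
    (hg : ContinuousOn g (Icc 0 h)) (hgd : ∀ y ∈ Ioo 0 h, DifferentiableAt ℝ g y)
    (hp : ∀ y ∈ Ioo 0 h, DifferentiableAt ℝ (fun z => z ^ (1 - σ) * deriv g z) y)
    (hB : ∀ y ∈ Ioo 0 h, deriv (fun z => z ^ (1 - σ) * deriv g z) y ≤ B * y ^ (1 - σ))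
    (hq : Tendsto (fun z => z ^ (1 - σ) * deriv g z) (𝓝[>] 0) (𝓝 q)) :
    g h - g 0 ≤ q * (h ^ σ / σ) + B / (2 - σ) / 2 * h ^ 2 := by
  have h2' : 0 < 2 - σ := by linarith
  -- First integration: the bound on the flux derivative, started from the limit `q` at `0`.
  have hflux : ∀ y ∈ Ioo 0 h, y ^ (1 - σ) * deriv g y ≤ q + B / (2 - σ) * y ^ (2 - σ) := by
    have hder : ∀ y ∈ Ioo 0 h, HasDerivAt
        (fun z => z ^ (1 - σ) * deriv g z - B / (2 - σ) * z ^ (2 - σ))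
        (deriv (fun z => z ^ (1 - σ) * deriv g z) y -
          B / (2 - σ) * ((2 - σ) * y ^ (2 - σ - 1))) y := fun y hy =>
      (hp y hy).hasDerivAt.sub
        ((Real.hasDerivAt_rpow_const (Or.inl hy.1.ne')).const_mul _)
    have hanti : AntitoneOn (fun z => z ^ (1 - σ) * deriv g z - B / (2 - σ) * z ^ (2 - σ))
        (Ioo 0 h) := by
      refine antitoneOn_of_deriv_nonpos (convex_Ioo _ _)
        (fun y hy => (hder y hy).continuousAt.continuousWithinAt)
        (fun y hy => ?_) (fun y hy => ?_)
      · rw [interior_Ioo] at hy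
        exact (hder y hy).differentiableAt.differentiableWithinAt
      · rw [interior_Ioo] at hy
        rw [(hder y hy).deriv, show 2 - σ - 1 = 1 - σ by ring]
        have := hB y hy
        have e : B / (2 - σ) * ((2 - σ) * y ^ (1 - σ)) = B * y ^ (1 - σ) := by field_simp
        linarith
    intro y hy
    have hlim : Tendsto (fun z => z ^ (1 - σ) * deriv g z - B / (2 - σ) * z ^ (2 - σ)) (𝓝[>] 0)
        (𝓝 (q - B / (2 - σ) * 0)) := by
      refine hq.sub (Tendsto.const_mul _ ?_)
      have := (Real.continuousAt_rpow_const 0 (2 - σ) (Or.inr h2'.le)).tendsto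
      rw [Real.zero_rpow h2'.ne'] at this
      exact this.mono_left nhdsWithin_le_nhds
    have := ge_of_tendsto hlim (by
      filter_upwards [Ioo_mem_nhdsGT hy.1] with z hz
      exact hanti ⟨hz.1, hz.2.trans hy.2⟩ hy hz.2.le)
    simp only at this
    linarith
  have hder : ∀ y ∈ Ioo 0 h, HasDerivAt
      (fun z => g z - q * (z ^ σ / σ) - B / (2 - σ) / 2 * z ^ 2)
      (deriv g y - q * (σ * y ^ (σ - 1) / σ) - B / (2 - σ) / 2 * (2 * y)) y := by
    intro y hy
    refine ((hgd y hy).hasDerivAt.sub (((Real.hasDerivAt_rpow_const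
      (Or.inl hy.1.ne')).div_const σ).const_mul q)).sub (HasDerivAt.const_mul _ ?_)
    simpa using hasDerivAt_pow 2 y
  -- Second integration: the flux bound multiplied by `y ^ (σ - 1)` bounds `g'`.
  have hanti : AntitoneOn (fun z => g z - q * (z ^ σ / σ) - B / (2 - σ) / 2 * z ^ 2)
      (Icc 0 h) := by
    refine antitoneOn_of_deriv_nonpos (convex_Icc _ _) ?_ (fun y hy => ?_) (fun y hy => ?_)
    · refine (hg.sub (Continuous.continuousOn ?_)).sub (Continuous.continuousOn ?_)
      · exact continuous_const.mul ((continuous_id.rpow_const fun _ => Or.inr h0.le).div_const _)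
      · fun_prop
    · rw [interior_Icc] at hy
      exact (hder y hy).differentiableAt.differentiableWithinAt
    · rw [interior_Icc] at hy
      rw [(hder y hy).deriv]
      have e0 : 0 < y ^ (σ - 1) := Real.rpow_pos_of_pos hy.1 _
      have e1 := mul_le_mul_of_nonneg_right (hflux y hy) e0.le
      have e2 : y ^ (1 - σ) * y ^ (σ - 1) = 1 := by
        rw [← Real.rpow_add hy.1]; simp
      have e3 : y ^ (2 - σ) * y ^ (σ - 1) = y := by
        rw [← Real.rpow_add hy.1, show 2 - σ + (σ - 1) = 1 by ring, Real.rpow_one]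
      have e4 : q * (σ * y ^ (σ - 1) / σ) = q * y ^ (σ - 1) := by field_simp
      have e5 : y ^ (1 - σ) * deriv g y * y ^ (σ - 1) = deriv g y := by
        linear_combination deriv g y * e2
      have e6 : (q + B / (2 - σ) * y ^ (2 - σ)) * y ^ (σ - 1) =
          q * y ^ (σ - 1) + B / (2 - σ) * y := by
        linear_combination B / (2 - σ) * e3
      rw [e4]
      linarith
  have := hanti (left_mem_Icc.2 hh.le) (right_mem_Icc.2 hh.le) hh.le
  simp only [Real.zero_rpow h0.ne', zero_div, mul_zero, sub_zero, ne_eq, OfNat.ofNat_ne_zero,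
    not_false_eq_true, zero_pow] at this
  linarith

lemma abs_sub_le_of_weighted_deriv {σ B q h : ℝ} {g : ℝ → ℝ} (h0 : 0 < σ) (h2 : σ < 2)
    (hh : 0 < h) (hg : ContinuousOn g (Icc 0 h)) (hgd : ∀ y ∈ Ioo 0 h, DifferentiableAt ℝ g y)
    (hp : ∀ y ∈ Ioo 0 h, DifferentiableAt ℝ (fun z => z ^ (1 - σ) * deriv g z) y)
    (hB : ∀ y ∈ Ioo 0 h, |deriv (fun z => z ^ (1 - σ) * deriv g z) y| ≤ B * y ^ (1 - σ))
    (hq : Tendsto (fun z => z ^ (1 - σ) * deriv g z) (𝓝[>] 0) (𝓝 q)) :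
    |g h - g 0 - q * (h ^ σ / σ)| ≤ B / (2 - σ) / 2 * h ^ 2 := by
  have hneg : (fun z => z ^ (1 - σ) * deriv (fun y => -g y) z) =
      fun z => -(z ^ (1 - σ) * deriv g z) := by
    funext z
    rw [deriv.fun_neg]; ring
  have h1 := sub_le_of_weighted_deriv h0 h2 hh hg hgd hp (fun y hy => (abs_le.1 (hB y hy)).2) hq
  have h3 := sub_le_of_weighted_deriv (B := B) (q := -q) (g := fun y => -g y) h0 h2 hh hg.neg
    (fun y hy => (hgd y hy).neg)
    (fun y hy => by rw [hneg]; exact (hp y hy).neg)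
    (fun y hy => by
      rw [hneg, deriv.fun_neg]; linarith [(abs_le.1 (hB y hy)).1])
    (by rw [hneg]; exact hq.neg)
  rw [abs_le]
  constructor <;> linarith

/-- If `m g ^ ((m - 1) / m)` grows at most like `R y ^ σ`, then the derivative of `g` with respect to
`y ^ σ` at `0` is at most a multiple of `(g 0) ^ (1 / m)`. -/
lemma limit_le_of_pressure {σ m R h q : ℝ} {g : ℝ → ℝ} (h0 : 0 < σ) (hm : 1 < m) (hR : 0 ≤ R)
    (hh : 0 < h) (hg0 : 0 ≤ g 0) (hg : ∀ y ∈ Ioo 0 h, 0 ≤ g y)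
    (hpress : ∀ y ∈ Ioo 0 h,
      m * ((g y) ^ (1 / m)) ^ (m - 1) ≤ m * ((g 0) ^ (1 / m)) ^ (m - 1) + R * y ^ σ)
    (hlim : Tendsto (fun y => (g y - g 0) / y ^ σ) (𝓝[>] 0) (𝓝 q)) :
    q ≤ R / (m - 1) * (g 0) ^ (1 / m) := by
  have hm0 : 0 < m := by linarith
  have hm1 : 0 < m - 1 := by linarith
  -- The exponent that turns `u ^ (m - 1)` back into `g = u ^ m`. Since `β ≥ 1`, the tangent line
  -- inequality linearises the growth in `y ^ σ`; since `β - 1 = 1 / (m - 1)`, the limiting slope is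
  -- proportional to `u` at `0`.
  set β := m / (m - 1) with hβ
  have hβ1 : 1 ≤ β := by rw [hβ, le_div_iff₀ hm1]; linarith
  have hpow : ∀ v : ℝ, 0 ≤ v → ((v ^ (1 / m)) ^ (m - 1)) ^ β = v := by
    intro v hv
    rw [← Real.rpow_mul hv, ← Real.rpow_mul hv,
      show 1 / m * (m - 1) * β = 1 by rw [hβ]; field_simp, Real.rpow_one]
  set z₀ := ((g 0) ^ (1 / m)) ^ (m - 1) with hz₀
  have hz₀0 : 0 ≤ z₀ := Real.rpow_nonneg (Real.rpow_nonneg hg0 _) _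
  have hbound : ∀ y ∈ Ioo 0 h,
      (g y - g 0) / y ^ σ ≤ β * (z₀ + R / m * y ^ σ) ^ (β - 1) * (R / m) := by
    intro y hy
    have hyσ : 0 < y ^ σ := Real.rpow_pos_of_pos hy.1 _
    have hz : ((g y) ^ (1 / m)) ^ (m - 1) ≤ z₀ + R / m * y ^ σ := by
      have e : m * (z₀ + R / m * y ^ σ) = m * z₀ + R * y ^ σ := by field_simp
      exact le_of_mul_le_mul_left (by linarith [hpress y hy]) hm0
    have e1 := Real.rpow_le_rpow (Real.rpow_nonneg (Real.rpow_nonneg (hg y hy) _) _) hz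
      (by linarith : 0 ≤ β)
    rw [hpow _ (hg y hy)] at e1
    have e2 := rpow_sub_rpow_le hβ1 hz₀0
      (by linarith [(by positivity : 0 ≤ R / m * y ^ σ)] : z₀ ≤ z₀ + R / m * y ^ σ)
    rw [hz₀, hpow _ hg0, ← hz₀, add_sub_cancel_left] at e2
    rw [div_le_iff₀ hyσ]
    linarith
  have hlim2 : Tendsto (fun y : ℝ => β * (z₀ + R / m * y ^ σ) ^ (β - 1) * (R / m)) (𝓝[>] 0)
      (𝓝 (β * (z₀ + R / m * 0 ^ σ) ^ (β - 1) * (R / m))) := by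
    have hc : Continuous fun y : ℝ => β * (z₀ + R / m * y ^ σ) ^ (β - 1) * (R / m) :=
      (continuous_const.mul ((continuous_const.add (continuous_const.mul
        (continuous_id.rpow_const fun _ => Or.inr h0.le))).rpow_const
          fun _ => Or.inr (by linarith))).mul continuous_const
    exact (hc.tendsto 0).mono_left nhdsWithin_le_nhds
  have hle := le_of_tendsto_of_tendsto hlim hlim2 (by
    filter_upwards [Ioo_mem_nhdsGT hh] with y hy using hbound y hy)
  have hz₀β : z₀ ^ (β - 1) = (g 0) ^ (1 / m) := by
    rw [hz₀, ← Real.rpow_mul (Real.rpow_nonneg hg0 _),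
      show (m - 1) * (β - 1) = 1 by rw [hβ]; field_simp; ring, Real.rpow_one]
  rw [Real.zero_rpow h0.ne', mul_zero, add_zero, hz₀β] at hle
  have e : β * (g 0) ^ (1 / m) * (R / m) = R / (m - 1) * (g 0) ^ (1 / m) := by
    rw [hβ]; field_simp
  linarith

/-- First order Taylor expansion with a bound on the second derivative in an interval. -/
lemma abs_taylor_le {T B t τ : ℝ} {u : ℝ → ℝ} (hT : 0 < T) (hu : ContDiffOn ℝ 2 u (Icc 0 T))
    (hB : ∀ s ∈ Icc 0 T, |iteratedDerivWithin 2 u (Icc 0 T) s| ≤ B) (ht : t ∈ Icc 0 T)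
    (hτ : 0 ≤ τ) (htτ : t + τ ∈ Icc 0 T) :
    |u (t + τ) - (u t + τ * derivWithin u (Icc 0 T) t)| ≤ B * τ ^ 2 := by
  have hun : UniqueDiffOn ℝ (Icc 0 T) := uniqueDiffOn_Icc hT
  have hB0 : 0 ≤ B := (abs_nonneg _).trans (hB t ht)
  have hd1 : DifferentiableOn ℝ u (Icc 0 T) := hu.differentiableOn (by norm_num)
  have hd2 : DifferentiableOn ℝ (derivWithin u (Icc 0 T)) (Icc 0 T) :=
    (hu.derivWithin hun (m := 1) (by norm_num)).differentiableOn (by norm_num)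
  have hlip : ∀ s ∈ Icc 0 T, |derivWithin u (Icc 0 T) s - derivWithin u (Icc 0 T) t| ≤
      B * |s - t| := by
    intro s hs
    refine Convex.norm_image_sub_le_of_norm_derivWithin_le hd2 (fun z hz => ?_)
      (convex_Icc 0 T) ht hs
    have := hB z hz
    rwa [iteratedDerivWithin_succ, iteratedDerivWithin_one] at this
  have hsub : Icc t (t + τ) ⊆ Icc 0 T := Icc_subset_Icc ht.1 htτ.2
  -- The mean value inequality for `u` minus its tangent, whose slope is at most `B * τ`. This loses
  -- the factor 1/2 of Taylor's formula, which is harmless here.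
  have hmain := Convex.norm_image_sub_le_of_norm_hasDerivWithin_le
    (f := fun s => u s - derivWithin u (Icc 0 T) t * s) (C := B * τ) (s := Icc t (t + τ))
    (f' := fun s => derivWithin u (Icc 0 T) s - derivWithin u (Icc 0 T) t * 1)
    (fun s hs => (((hd1 s (hsub hs)).hasDerivWithinAt).mono hsub).sub
      ((hasDerivWithinAt_id s _).const_mul _))
    (fun s hs => by
      rw [mul_one]
      refine (hlip s (hsub hs)).trans (mul_le_mul_of_nonneg_left ?_ hB0)
      rw [abs_of_nonneg (by linarith [hs.1])]; linarith [hs.2])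
    (convex_Icc _ _) (left_mem_Icc.2 (by linarith)) (right_mem_Icc.2 (by linarith))
  simp only [Real.norm_eq_abs, add_sub_cancel_left, abs_of_nonneg hτ] at hmain
  calc _ = |u (t + τ) - derivWithin u (Icc 0 T) t * (t + τ) -
        (u t - derivWithin u (Icc 0 T) t * t)| := by congr 1; ring
    _ ≤ _ := hmain
    _ = _ := by ring

/-- The equation and the spatial bounds hold only for `t > 0`, while the scheme starts at `t = 0`;
continuity in time closes the gap. -/
lemma le_on_Icc_of_le_on_Ioc {T : ℝ} {φ ψ : ℝ → ℝ} (hT : 0 < T) (hφ : ContinuousOn φ (Icc 0 T))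
    (hψ : ContinuousOn ψ (Icc 0 T)) (h : ∀ t ∈ Ioc 0 T, φ t ≤ ψ t) :
    ∀ t ∈ Icc 0 T, φ t ≤ ψ t := by
  intro t ht
  rw [← closure_Ioc hT.ne] at hφ hψ ht
  exact le_on_closure h hφ hψ ht

/-! ### The exact solution: maximum principles, flux expansion and growth bound. -/

namespace IsClassicalSolution

variable {σ m X Y T : ℝ} {f : ℝ → ℝ} {w : ℝ → ℝ → ℝ → ℝ}

lemma continuousOn_slice_time (hw : IsClassicalSolution σ m X Y T f w) {x y : ℝ}
    (hx : x ∈ Icc (-X) X) (hy : y ∈ Icc 0 Y) : ContinuousOn (fun t => w x y t) (Icc 0 T) :=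
  hw.continuousOn.comp (f := fun t => (x, y, t)) (by fun_prop) fun _ ht => ⟨hx, hy, ht⟩

lemma continuousOn_slice_vertical (hw : IsClassicalSolution σ m X Y T f w) {x t : ℝ}
    (hx : x ∈ Icc (-X) X) (ht : t ∈ Icc 0 T) : ContinuousOn (fun y => w x y t) (Icc 0 Y) :=
  hw.continuousOn.comp (f := fun y => (x, y, t)) (by fun_prop) fun _ hy => ⟨hx, hy, ht⟩

/-- The side condition is imposed only for `y > 0`; continuity adds the corners on the base. -/
lemma lateral_corner (hw : IsClassicalSolution σ m X Y T f w) (hX : 0 < X) (hY : 0 < Y) {x y t : ℝ}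
    (hx : x = -X ∨ x = X) (hy : y ∈ Icc 0 Y) (ht : t ∈ Icc 0 T) : w x y t = 0 := by
  have hxI : x ∈ Icc (-X) X := by
    rcases hx with rfl | rfl <;> constructor <;> linarith
  have hpos : EqOn (fun y => w x y t) (fun _ => 0) (Ioc 0 Y) := by
    intro z hz
    rcases hx with rfl | rfl
    · exact (hw.lateral z hz t ht).1
    · exact (hw.lateral z hz t ht).2
  have hc := hw.continuousOn_slice_vertical hxI ht
  rw [← closure_Ioc hY.ne] at hc hy
  exact hpos.of_subset_closure hc continuousOn_const subset_closure subset_rfl hy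

lemma contDiffOn_vertical (hw : IsClassicalSolution σ m X Y T f w) {x t : ℝ}
    (hx : x ∈ Ioo (-X) X) (ht : t ∈ Ioc 0 T) : ContDiffOn ℝ 2 (fun y => w x y t) (Ioo 0 Y) :=
  (hw.contDiffOn t ht).comp (f := fun y => (x, y)) (by fun_prop) fun _ hy => ⟨hx, hy⟩

lemma differentiableAt_vertical (hw : IsClassicalSolution σ m X Y T f w) {x y t : ℝ}
    (hx : x ∈ Ioo (-X) X) (hy : y ∈ Ioo 0 Y) (ht : t ∈ Ioc 0 T) :
    DifferentiableAt ℝ (fun y => w x y t) y :=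
  ((hw.contDiffOn_vertical hx ht).differentiableOn (by norm_num)).differentiableAt
    (isOpen_Ioo.mem_nhds hy)

lemma differentiableAt_flux (hw : IsClassicalSolution σ m X Y T f w) {x y t : ℝ}
    (hx : x ∈ Ioo (-X) X) (hy : y ∈ Ioo 0 Y) (ht : t ∈ Ioc 0 T) :
    DifferentiableAt ℝ (fun z => z ^ (1 - σ) * deriv (fun y => w x y t) z) y := by
  refine (Real.differentiableAt_rpow_const_of_ne _ hy.1.ne').mul ?_
  exact (((hw.contDiffOn_vertical hx ht).deriv_of_isOpen isOpen_Ioo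
    (m := 1) (by norm_num)).differentiableOn (by norm_num)).differentiableAt
      (isOpen_Ioo.mem_nhds hy)

/-- The weight does not depend on `x`, so the equation controls the vertical variation of the flux
by `w_xx`. -/
lemma deriv_flux (hw : IsClassicalSolution σ m X Y T f w) {x y t : ℝ}
    (hx : x ∈ Ioo (-X) X) (hy : y ∈ Ioo 0 Y) (ht : t ∈ Ioc 0 T) :
    deriv (fun z => z ^ (1 - σ) * deriv (fun y => w x y t) z) y =
      -(y ^ (1 - σ) * deriv (fun z => deriv (fun x => w x y t) z) x) := by
  have h := hw.extension_eq x hx y hy t ht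
  unfold Lsigma at h
  rw [deriv_const_mul_field] at h
  linarith

/-- The weak maximum principle for the extension at a fixed positive time. -/
lemma le_of_base_le (hw : IsClassicalSolution σ m X Y T f w) (hX : 0 < X) (hY : 0 < Y) {c t : ℝ}
    (ht : t ∈ Ioc 0 T) (hc : 0 ≤ c) (hbase : ∀ x ∈ Icc (-X) X, w x 0 t ≤ c) :
    ∀ x ∈ Icc (-X) X, ∀ y ∈ Icc 0 Y, w x y t ≤ c := by
  have ht' : t ∈ Icc 0 T := ⟨ht.1.le, ht.2⟩
  have key : ∀ η > 0, ∀ x ∈ Icc (-X) X, ∀ y ∈ Icc 0 Y, w x y t ≤ c + η * X ^ 2 := by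
    intro η hη
    -- The perturbation makes the maximum principle strict: at an interior maximum the vertical test
    -- and the equation give `w_xx ≥ 0`, the horizontal test `w_xx ≤ -2η`.
    set z : ℝ × ℝ → ℝ := fun p => w p.1 p.2 t + η * p.1 ^ 2 with hz
    have hcont : ContinuousOn z (Icc (-X) X ×ˢ Icc 0 Y) := by
      refine ContinuousOn.add ?_ (by fun_prop)
      exact hw.continuousOn.comp (f := fun p : ℝ × ℝ => (p.1, p.2, t)) (by fun_prop)
        fun p hp => ⟨hp.1, hp.2, ht'⟩
    obtain ⟨⟨x₁, y₁⟩, ⟨hx₁, hy₁⟩, hmax⟩ := (isCompact_Icc.prod isCompact_Icc).exists_isMaxOn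
      ⟨((0 : ℝ), (0 : ℝ)), ⟨⟨by linarith, hX.le⟩, ⟨le_rfl, hY.le⟩⟩⟩ hcont
    simp only at hx₁ hy₁
    have hmax' : ∀ x ∈ Icc (-X) X, ∀ y ∈ Icc 0 Y,
        w x y t + η * x ^ 2 ≤ w x₁ y₁ t + η * x₁ ^ 2 := 
      fun x hx y hy => hmax (Set.mk_mem_prod hx hy)
    have hval : w x₁ y₁ t ≤ c := by
      by_contra! hgt
      have hx₂ : x₁ ∈ Ioo (-X) X := by
        refine ⟨lt_of_le_of_ne hx₁.1 fun h => ?_, lt_of_le_of_ne hx₁.2 fun h => ?_⟩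
        · rw [hw.lateral_corner hX hY (Or.inl h.symm) hy₁ ht'] at hgt; linarith
        · rw [hw.lateral_corner hX hY (Or.inr h) hy₁ ht'] at hgt; linarith
      have hy₂ : y₁ ∈ Ioo 0 Y := by
        refine ⟨lt_of_le_of_ne hy₁.1 fun h => ?_, lt_of_le_of_ne hy₁.2 fun h => ?_⟩
        · rw [← h] at hgt; linarith [hbase x₁ hx₁]
        · rw [h, hw.top x₁ hx₁ t ht'] at hgt; linarith
      have hyloc : IsLocalMax (fun y => w x₁ y t) y₁ := by
        filter_upwards [isOpen_Ioo.mem_nhds hy₂] with y hy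
        linarith [hmax' x₁ hx₁ y ⟨hy.1.le, hy.2.le⟩]
      have hxloc : IsLocalMax (fun x => w x y₁ t + η * x ^ 2) x₁ := by
        filter_upwards [isOpen_Ioo.mem_nhds hx₂] with x hx
        exact hmax' x ⟨hx.1.le, hx.2.le⟩ y₁ hy₁
      have hcd : ContDiffOn ℝ 2 (fun x => w x y₁ t) (Ioo (-X) X) :=
        (hw.contDiffOn t ht).comp (f := fun x => (x, y₁)) (by fun_prop) fun _ hx => ⟨hx, hy₂⟩
      have hd1 : ∀ x ∈ Ioo (-X) X, DifferentiableAt ℝ (fun x => w x y₁ t) x := fun x hx =>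
        (hcd.differentiableOn (by norm_num)).differentiableAt (isOpen_Ioo.mem_nhds hx)
      have hd2 : DifferentiableAt ℝ (deriv fun x => w x y₁ t) x₁ :=
        ((hcd.deriv_of_isOpen isOpen_Ioo (m := 1) (by norm_num)).differentiableOn
          (by norm_num)).differentiableAt (isOpen_Ioo.mem_nhds hx₂)
      have hdx : ∀ x ∈ Ioo (-X) X, deriv (fun x => w x y₁ t + η * x ^ 2) x =
          deriv (fun x => w x y₁ t) x + η * (2 * x) := by
        intro x hx
        have h1 : HasDerivAt (fun x : ℝ => x ^ 2) (2 * x) x := by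
          simpa using hasDerivAt_pow 2 x
        exact ((hd1 x hx).hasDerivAt.add (h1.const_mul η)).deriv
      have e1 := deriv_mul_deriv_nonpos_of_isLocalMax (ρ := fun _ => 1)
        (g := fun x => w x y₁ t + η * x ^ 2)
        (Eventually.of_forall fun _ => one_pos)
        ((hd1 x₁ hx₂).continuousAt.add (by fun_prop)) hxloc
      have e2 := deriv_mul_deriv_nonpos_of_isLocalMax (ρ := fun z => z ^ (1 - σ))
        (by filter_upwards [lt_mem_nhds hy₂.1] with z hz using Real.rpow_pos_of_pos hz _)
        (hw.differentiableAt_vertical hx₂ hy₂ ht).continuousAt hyloc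
      rw [hw.deriv_flux hx₂ hy₂ ht] at e2
      have e3 : deriv (fun z => (1 : ℝ) * deriv (fun x => w x y₁ t + η * x ^ 2) z) x₁ =
          deriv (fun z => deriv (fun x => w x y₁ t) z) x₁ + η * 2 := by
        have heq : (fun z => (1 : ℝ) * deriv (fun x => w x y₁ t + η * x ^ 2) z) =ᶠ[𝓝 x₁]
            fun z => deriv (fun x => w x y₁ t) z + η * (2 * z) := by
          filter_upwards [isOpen_Ioo.mem_nhds hx₂] with x hx
          rw [one_mul, hdx x hx]
        rw [heq.deriv_eq]
        have h1 : HasDerivAt (fun z : ℝ => η * (2 * z)) (η * 2) x₁ := by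
          simpa using ((hasDerivAt_id x₁).const_mul 2).const_mul η
        exact (hd2.hasDerivAt.add h1).deriv
      have e4 : 0 < y₁ ^ (1 - σ) := Real.rpow_pos_of_pos hy₂.1 _
      have e5 : 0 ≤ deriv (fun z => deriv (fun x => w x y₁ t) z) x₁ := by
        by_contra! hneg
        nlinarith
      rw [e3] at e1
      linarith
    intro x hx y hy
    have h1 := hmax' x hx y hy
    have h2 : x₁ ^ 2 ≤ X ^ 2 := sq_le_sq' hx₁.1 hx₁.2
    nlinarith [sq_nonneg x]
  intro x hx y hy
  refine le_of_forall_pos_le_add fun e he => ?_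
  have hX2 : 0 < X ^ 2 := by positivity
  have := key (e / X ^ 2) (by positivity) x hx y hy
  rwa [div_mul_cancel₀ e hX2.ne'] at this

lemma w_eq_trace_rpow (hw : IsClassicalSolution σ m X Y T f w) (hm : 1 ≤ m) (hY : 0 < Y) {x t : ℝ}
    (hx : x ∈ Icc (-X) X) (ht : t ∈ Icc 0 T) : w x 0 t = trace m w x t ^ m :=
  (rpow_rpow_one_div hm (hw.nonneg x hx 0 ⟨le_rfl, hY.le⟩ t ht)).symm

lemma trace_nonneg (hw : IsClassicalSolution σ m X Y T f w) (hY : 0 < Y) {x t : ℝ}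
    (hx : x ∈ Icc (-X) X) (ht : t ∈ Icc 0 T) : 0 ≤ trace m w x t :=
  Real.rpow_nonneg (hw.nonneg x hx 0 ⟨le_rfl, hY.le⟩ t ht) _

lemma trace_zero (hw : IsClassicalSolution σ m X Y T f w) (hm : 1 ≤ m)
    (hf : ∀ x ∈ Icc (-X) X, 0 ≤ f x) {x : ℝ} (hx : x ∈ Icc (-X) X) : trace m w x 0 = f x := by
  rw [trace, hw.initial x hx, rpow_one_div_rpow hm (hf x hx)]

lemma continuousOn_trace (hw : IsClassicalSolution σ m X Y T f w) (hm : 1 ≤ m) (hY : 0 < Y) :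
    ContinuousOn (fun p : ℝ × ℝ => trace m w p.1 p.2) (Icc (-X) X ×ˢ Icc 0 T) := by
  refine ContinuousOn.rpow_const ?_ fun _ _ => Or.inr (by positivity)
  exact hw.continuousOn.comp (f := fun p : ℝ × ℝ => (p.1, (0 : ℝ), p.2)) (by fun_prop)
    fun p hp => ⟨hp.1, ⟨le_rfl, hY.le⟩, hp.2⟩

/-- The supremum is meaningful because `f` is the initial trace of the continuous `w`, hence
bounded. -/
lemma le_supNorm (hw : IsClassicalSolution σ m X Y T f w) (hm : 1 ≤ m) (hY : 0 < Y) (hT : 0 < T)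
    (hf : ∀ x ∈ Icc (-X) X, 0 ≤ f x) {x : ℝ} (hx : x ∈ Icc (-X) X) : f x ≤ supNorm X f := by
  have hcont : ContinuousOn f (Icc (-X) X) := by
    have h1 : ContinuousOn (fun x => trace m w x 0) (Icc (-X) X) :=
      (hw.continuousOn_trace hm hY).comp (f := fun x => (x, (0 : ℝ))) (by fun_prop)
        fun _ hx => ⟨hx, ⟨le_rfl, hT.le⟩⟩
    exact h1.congr fun x hx => (hw.trace_zero hm hf hx).symm
  exact le_csSup (isCompact_Icc.bddAbove_image hcont) ⟨x, hx, rfl⟩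

/-- The maximum principle for the evolution problem: on the base `u` never exceeds its initial
supremum. -/
lemma trace_le_supNorm (hw : IsClassicalSolution σ m X Y T f w) (h0 : 0 < σ) (h2 : σ < 2)
    (hm : 1 ≤ m) (hX : 0 < X) (hY : 0 < Y) (hT : 0 < T) (hf : ∀ x ∈ Icc (-X) X, 0 ≤ f x)
    {x t : ℝ} (hx : x ∈ Icc (-X) X) (ht : t ∈ Icc 0 T) : trace m w x t ≤ supNorm X f := by
  have hm0 : 0 < m := by linarith
  have hM0 : 0 ≤ supNorm X f :=
    (hf 0 ⟨by linarith, hX.le⟩).trans (hw.le_supNorm hm hY hT hf ⟨by linarith, hX.le⟩)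
  have key : ∀ η > 0, ∀ x ∈ Icc (-X) X, ∀ t ∈ Icc 0 T,
      trace m w x t ≤ supNorm X f + η * T := by
    intro η hη
    -- At a maximum with `t₁ > 0` and too large a value, `∂_t u ≥ η > 0`. The conormal derivative is
    -- then positive and `w` rises above the base, although the extension attains its maximum there.
    set z : ℝ × ℝ → ℝ := fun p => trace m w p.1 p.2 - η * p.2 with hz
    have hcont : ContinuousOn z (Icc (-X) X ×ˢ Icc 0 T) :=
      (hw.continuousOn_trace hm hY).sub (by fun_prop)
    obtain ⟨⟨x₁, t₁⟩, ⟨hx₁, ht₁⟩, hmax⟩ := (isCompact_Icc.prod isCompact_Icc).exists_isMaxOn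
      ⟨((0 : ℝ), (0 : ℝ)), ⟨⟨by linarith, hX.le⟩, ⟨le_rfl, hT.le⟩⟩⟩ hcont
    simp only at hx₁ ht₁
    have hmax' : ∀ x ∈ Icc (-X) X, ∀ t ∈ Icc 0 T,
        trace m w x t - η * t ≤ trace m w x₁ t₁ - η * t₁ :=
      fun x hx t ht => hmax (Set.mk_mem_prod hx ht)
    have hval : trace m w x₁ t₁ - η * t₁ ≤ supNorm X f := by
      by_contra! hgt
      have ht₂ : t₁ ∈ Ioc 0 T := by
        refine ⟨lt_of_le_of_ne ht₁.1 fun h => ?_, ht₁.2⟩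
        rw [← h, hw.trace_zero hm hf hx₁] at hgt
        linarith [hw.le_supNorm hm hY hT hf hx₁]
      have hηt : 0 ≤ η * t₁ := mul_nonneg hη.le ht₁.1
      have hside : ∀ x, x = -X ∨ x = X → trace m w x t₁ = 0 := by
        intro x hx
        rw [trace, hw.lateral_corner hX hY hx ⟨le_rfl, hY.le⟩ ht₁,
          Real.zero_rpow (by positivity)]
      have hx₂ : x₁ ∈ Ioo (-X) X := by
        refine ⟨lt_of_le_of_ne hx₁.1 fun h => ?_, lt_of_le_of_ne hx₁.2 fun h => ?_⟩
        · rw [hside x₁ (Or.inl h.symm)] at hgt; linarith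
        · rw [hside x₁ (Or.inr h)] at hgt; linarith
      have hder : η ≤ derivWithin (trace m w x₁) (Icc 0 T) t₁ := by
        have hloc : IsLocalMaxOn (fun t => trace m w x₁ t - η * t) (Icc 0 T) t₁ := by
          filter_upwards [self_mem_nhdsWithin] with t ht
          exact hmax' x₁ hx₁ t ht
        have hd : HasDerivWithinAt (fun t => trace m w x₁ t - η * t)
            (derivWithin (trace m w x₁) (Icc 0 T) t₁ - η * 1) (Icc 0 T) t₁ :=
          (hw.differentiable_trace x₁ hx₂ t₁ ht₂).hasDerivWithinAt.sub
            ((hasDerivWithinAt_id t₁ _).const_mul η)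
        -- The backward direction is admissible even at `t₁ = T`, and it suffices for the sign.
        have hcone : (0 - t₁) ∈ posTangentConeAt (Icc 0 T) t₁ :=
          sub_mem_posTangentConeAt_of_segment_subset
            ((convex_Icc 0 T).segment_subset ht₁ ⟨le_rfl, hT.le⟩)
        have := hloc.hasFDerivWithinAt_nonpos hd.hasFDerivWithinAt hcone
        simp at this
        nlinarith [ht₂.1]
      have hbase : ∀ x ∈ Icc (-X) X, w x 0 t₁ ≤ w x₁ 0 t₁ := by
        intro x hx
        rw [hw.w_eq_trace_rpow hm hY hx ht₁, hw.w_eq_trace_rpow hm hY hx₁ ht₁]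
        exact Real.rpow_le_rpow (hw.trace_nonneg hY hx ht₁) (by linarith [hmax' x hx t₁ ht₁])
          hm0.le
      have hcol := hw.le_of_base_le hX hY ht₂
        (hw.nonneg x₁ hx₁ 0 ⟨le_rfl, hY.le⟩ t₁ ht₁) hbase x₁ hx₁
      have hpos : ∀ᶠ y in 𝓝[>] 0, 0 < deriv (fun y' => w x₁ y' t₁) y := by
        have h3 := (hw.base_eq x₁ hx₂ t₁ ht₂).eventually_const_lt (hη.trans_le hder)
        filter_upwards [h3, self_mem_nhdsWithin] with y hy hy0
        have h4 := pos_of_mul_pos_right hy (mu_pos h0 h2).le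
        exact pos_of_mul_pos_right h4 (Real.rpow_pos_of_pos hy0 _).le
      obtain ⟨d, hd, hdpos⟩ := (mem_nhdsGT_iff_exists_Ioo_subset).1 hpos
      have hd0 : (0 : ℝ) < d := hd
      set e := min d Y with he
      have he0 : 0 < e := lt_min hd0 hY
      have hmono : StrictMonoOn (fun y => w x₁ y t₁) (Icc 0 e) := by
        refine strictMonoOn_of_deriv_pos (convex_Icc _ _)
          ((hw.continuousOn_slice_vertical hx₁ ht₁).mono
            (Icc_subset_Icc le_rfl (min_le_right _ _))) fun y hy => ?_
        rw [interior_Icc] at hy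
        exact hdpos ⟨hy.1, hy.2.trans_le (min_le_left _ _)⟩
      have := hmono (left_mem_Icc.2 he0.le) (right_mem_Icc.2 he0.le) he0
      have h5 := hcol e ⟨he0.le, min_le_right _ _⟩
      simp only at this
      linarith
    intro x hx t ht
    have h1 := hmax' x hx t ht
    have h3 := ht.2
    nlinarith
  refine le_of_forall_pos_le_add fun e he => ?_
  have := key (e / T) (by positivity) x hx t ht
  rwa [div_mul_cancel₀ e hT.ne'] at this

/-- The difference quotient of the scheme approximates the conormal derivative up to
`O(h ^ (2 - σ))`. -/
lemma exists_flux_bound (hw : IsClassicalSolution σ m X Y T f w) (hreg : IsRegular σ m X Y T w)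
    (h0 : 0 < σ) (h2 : σ < 2) (hT : 0 < T) :
    ∃ C : ℝ, 0 ≤ C ∧ ∀ x ∈ Ioo (-X) X, ∀ t ∈ Icc 0 T, ∀ h ∈ Ioc 0 Y,
      |nu σ * ((w x h t - w x 0 t) / h ^ σ) - derivWithin (trace m w x) (Icc 0 T) t| ≤
        C * h ^ (2 - σ) := by
  obtain ⟨B, hB⟩ := hreg.bound_space
  have hμ := mu_pos h0 h2
  have hν := nu_pos h0 h2
  refine ⟨nu σ * (|B| / (2 - σ) / 2), ?_, ?_⟩
  · have : 0 < 2 - σ := by linarith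
    positivity
  intro x hx t ht h hh
  have hx' : x ∈ Icc (-X) X := ⟨hx.1.le, hx.2.le⟩
  have hYc : 0 < Y := hh.1.trans_le hh.2
  refine le_on_Icc_of_le_on_Ioc hT (φ := fun t =>
    |nu σ * ((w x h t - w x 0 t) / h ^ σ) - derivWithin (trace m w x) (Icc 0 T) t|)
    (ψ := fun _ => nu σ * (|B| / (2 - σ) / 2) * h ^ (2 - σ)) ?_ continuousOn_const ?_ t ht
  · have c1 := hw.continuousOn_slice_time hx' ⟨hh.1.le, hh.2⟩
    have c2 := hw.continuousOn_slice_time hx' ⟨le_rfl, hYc.le⟩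
    have c3 := (hreg.contDiffOn_time x hx).continuousOn_derivWithin (uniqueDiffOn_Icc hT)
      (by norm_num)
    exact ((continuousOn_const.mul ((c1.sub c2).div_const _)).sub c3).abs
  intro t ht
  have ht' : t ∈ Icc 0 T := ⟨ht.1.le, ht.2⟩
  set D := derivWithin (trace m w x) (Icc 0 T) t with hD
  have hsub : Ioo 0 h ⊆ Ioo 0 Y := Ioo_subset_Ioo le_rfl hh.2
  have hq : Tendsto (fun z => z ^ (1 - σ) * deriv (fun y => w x y t) z) (𝓝[>] 0)
      (𝓝 ((mu σ)⁻¹ * D)) := by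
    have := (hw.base_eq x hx t ht).const_mul (mu σ)⁻¹
    simpa only [← mul_assoc, inv_mul_cancel₀ hμ.ne', one_mul] using this
  have hmain := abs_sub_le_of_weighted_deriv (B := |B|) h0 h2 hh.1
    ((hw.continuousOn_slice_vertical hx' ht').mono (Icc_subset_Icc le_rfl hh.2))
    (fun y hy => hw.differentiableAt_vertical hx (hsub hy) ht)
    (fun y hy => hw.differentiableAt_flux hx (hsub hy) ht)
    (fun y hy => by
      have h3 := hB x hx y (hsub hy) t ht
      rw [iteratedDeriv_succ, iteratedDeriv_one] at h3
      have h4 : 0 ≤ y ^ (1 - σ) := Real.rpow_nonneg hy.1.le _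
      rw [hw.deriv_flux hx (hsub hy) ht, abs_neg, abs_mul, abs_of_nonneg h4, mul_comm]
      exact mul_le_mul_of_nonneg_right (h3.trans (le_abs_self B)) h4) hq
  have hhσ : 0 < h ^ σ := Real.rpow_pos_of_pos hh.1 _
  -- The factor `σ` in `ν_σ = σ μ_σ` cancels the one in `h ^ σ / σ`.
  have e1 : nu σ * ((w x h t - w x 0 t) / h ^ σ) - D =
      nu σ / h ^ σ * (w x h t - w x 0 t - (mu σ)⁻¹ * D * (h ^ σ / σ)) := by
    simp only [nu]; field_simp
  have e2 : h ^ 2 = h ^ (2 - σ) * h ^ σ := by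
    rw [← Real.rpow_add hh.1, sub_add_cancel, Real.rpow_two]
  rw [e1, abs_mul, abs_of_pos (by positivity : 0 < nu σ / h ^ σ)]
  calc nu σ / h ^ σ * |w x h t - w x 0 t - (mu σ)⁻¹ * D * (h ^ σ / σ)|
      ≤ nu σ / h ^ σ * (|B| / (2 - σ) / 2 * h ^ 2) := by gcongr
    _ = _ := by rw [e2]; field_simp

/-- The time derivative of the trace is bounded above by a multiple of the trace. -/
lemma exists_deriv_le (hw : IsClassicalSolution σ m X Y T f w) (hreg : IsRegular σ m X Y T w)
    (h0 : 0 < σ) (h2 : σ < 2) (hm : 1 ≤ m) (hY : 0 < Y) (hT : 0 < T) :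
    ∃ κ : ℝ, 0 ≤ κ ∧ ∀ x ∈ Ioo (-X) X, ∀ t ∈ Icc 0 T,
      m = 1 ∨ derivWithin (trace m w x) (Icc 0 T) t ≤ κ * trace m w x t := by
  rcases hm.eq_or_lt with hm1 | hm1
  · exact ⟨0, le_rfl, fun _ _ _ _ => Or.inl hm1.symm⟩
  obtain ⟨R, hR⟩ := hreg.bound_pressure
  obtain ⟨C, hC0, hC⟩ := hw.exists_flux_bound hreg h0 h2 hT
  have hν := nu_pos h0 h2
  have hm1' : 0 < m - 1 := by linarith
  refine ⟨nu σ * (|R| / (m - 1)), by positivity, fun x hx t ht => Or.inr ?_⟩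
  have hx' : x ∈ Icc (-X) X := ⟨hx.1.le, hx.2.le⟩
  refine le_on_Icc_of_le_on_Ioc hT (φ := fun t => derivWithin (trace m w x) (Icc 0 T) t)
    (ψ := fun t => nu σ * (|R| / (m - 1)) * trace m w x t) ?_ ?_ ?_ t ht
  · exact (hreg.contDiffOn_time x hx).continuousOn_derivWithin (uniqueDiffOn_Icc hT)
      (by norm_num)
  · exact continuousOn_const.mul (hreg.contDiffOn_time x hx).continuousOn
  intro t ht
  have ht' : t ∈ Icc 0 T := ⟨ht.1.le, ht.2⟩
  set D := derivWithin (trace m w x) (Icc 0 T) t with hD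
  have hlim : Tendsto (fun y => (w x y t - w x 0 t) / y ^ σ) (𝓝[>] 0) (𝓝 ((nu σ)⁻¹ * D)) := by
    have h3 : Tendsto (fun y => nu σ * ((w x y t - w x 0 t) / y ^ σ)) (𝓝[>] 0) (𝓝 D) := by
      rw [tendsto_iff_norm_sub_tendsto_zero]
      have h4 : Tendsto (fun y : ℝ => C * y ^ (2 - σ)) (𝓝[>] 0) (𝓝 0) := by
        have := ((Real.continuousAt_rpow_const 0 (2 - σ)
          (Or.inr (by linarith))).tendsto.const_mul C).mono_left
            (nhdsWithin_le_nhds (s := Ioi 0))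
        rwa [Real.zero_rpow (by linarith), mul_zero] at this
      refine squeeze_zero' (Eventually.of_forall fun _ => norm_nonneg _) ?_ h4
      filter_upwards [Ioo_mem_nhdsGT hY] with y hy
      exact hC x hx t ht' y ⟨hy.1, hy.2.le⟩
    have := h3.const_mul (nu σ)⁻¹
    simpa only [← mul_assoc, inv_mul_cancel₀ hν.ne', one_mul] using this
  have hmain := limit_le_of_pressure h0 hm1 (abs_nonneg R) hY
    (hw.nonneg x hx' 0 ⟨le_rfl, hY.le⟩ t ht')
    (fun y hy => hw.nonneg x hx' y ⟨hy.1.le, hy.2.le⟩ t ht')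
    (fun y hy => (hR x hx y hy t ht).trans (by
      have := Real.rpow_nonneg hy.1.le σ
      gcongr
      exact le_abs_self R)) hlim
  have e : D = nu σ * ((nu σ)⁻¹ * D) := by field_simp
  rw [e, mul_assoc]
  exact mul_le_mul_of_nonneg_left hmain hν.le

/-- Compactness; this crude bound serves only on coarse meshes. -/
lemma exists_bound (hw : IsClassicalSolution σ m X Y T f w) :
    ∃ N : ℝ, ∀ x ∈ Icc (-X) X, ∀ y ∈ Icc 0 Y, ∀ t ∈ Icc 0 T, w x y t ≤ N := by
  obtain ⟨N, hN⟩ := (isCompact_Icc.prod (isCompact_Icc.prod isCompact_Icc)).bddAbove_image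
    hw.continuousOn
  exact ⟨N, fun x hx y hy t ht => hN ⟨(x, y, t), ⟨hx, hy, ht⟩, rfl⟩⟩

end IsClassicalSolution

/-! ### The barrier for `L_σ`. -/

/-- A smooth barrier: nonnegative, bounded, and with `L_σ v` bounded below by a positive constant. -/
lemma exists_barrier {σ X Y : ℝ} (h0 : 0 < σ) (hY : 0 < Y) :
    ∃ v : ℝ → ℝ → ℝ, ContDiff ℝ ∞ (fun p : ℝ × ℝ => v p.1 p.2) ∧ ∃ c > 0, ∃ V : ℝ,
      (∀ x ∈ Icc (-X) X, ∀ y ∈ Icc 0 Y, 0 ≤ v x y ∧ v x y ≤ V) ∧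
      ∀ x, ∀ y ∈ Ioo 0 Y, c ≤ Lsigma σ v x y := by
  rcases lt_or_ge σ 1 with h1 | h1
  -- For `σ < 1` the weight increases with `y`, so `v = y` works; at `σ = 1` its image vanishes, and
  -- from there on `v = x ^ 2` is used, whose image `2 y ^ (1 - σ)` is smallest at `y = Y`.
  · refine ⟨fun _ y => y, contDiff_snd, (1 - σ) * Y ^ (-σ),
      mul_pos (by linarith) (Real.rpow_pos_of_pos hY _), Y, fun _ _ y hy => hy, fun x y hy => ?_⟩
    have e1 : deriv (fun y' : ℝ => y' ^ (1 - σ) * deriv (fun y'' => y'') y') y =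
        (1 - σ) * y ^ (-σ) := by
      have : (fun y' : ℝ => y' ^ (1 - σ) * deriv (fun y'' => y'') y') = fun y' => y' ^ (1 - σ) := by
        funext z; simp
      rw [this, (Real.hasDerivAt_rpow_const (Or.inl hy.1.ne')).deriv]
      congr 2; ring
    have e2 : Lsigma σ (fun _ y => y) x y = (1 - σ) * y ^ (-σ) := by
      unfold Lsigma
      rw [e1]; simp
    rw [e2]
    have := Real.rpow_le_rpow_of_nonpos hy.1 hy.2.le (by linarith : -σ ≤ 0)
    exact mul_le_mul_of_nonneg_left this (by linarith)
  · refine ⟨fun x _ => x ^ 2, contDiff_fst.pow 2, Y ^ (1 - σ) * 2,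
      mul_pos (Real.rpow_pos_of_pos hY _) two_pos, X ^ 2,
      fun x hx _ _ => ⟨sq_nonneg x, sq_le_sq' hx.1 hx.2⟩, fun x y hy => ?_⟩
    have e1 : deriv (fun x' : ℝ => y ^ (1 - σ) * deriv (fun x'' => x'' ^ 2) x') x =
        y ^ (1 - σ) * 2 := by
      have : (fun x' : ℝ => y ^ (1 - σ) * deriv (fun x'' => x'' ^ 2) x') =
          fun x' => y ^ (1 - σ) * (2 * x') := by
        funext z; simp
      rw [this, deriv_const_mul_field, deriv_const_mul_field]; simp
    have e2 : Lsigma σ (fun x _ => x ^ 2) x y = y ^ (1 - σ) * 2 := by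
      unfold Lsigma
      rw [e1]; simp
    rw [e2]
    have := Real.rpow_le_rpow_of_nonpos hy.1 hy.2.le (by linarith : 1 - σ ≤ 0)
    exact mul_le_mul_of_nonneg_right this two_pos.le

/-! ### Geometry of the mesh. -/

section Mesh

variable {X Y : ℝ} {I K : ℕ}

lemma IsMesh.dx_pos (h : IsMesh X Y I K) (hX : 0 < X) : 0 < dx X I := by
  have : (0 : ℝ) < I := by exact_mod_cast h.1
  unfold dx; positivity

lemma IsMesh.mul_dx (h : IsMesh X Y I K) : I * dx X I = 2 * X := by
  have : (0 : ℝ) < I := by exact_mod_cast h.1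
  unfold dx; field_simp

lemma IsMesh.mul_dy (h : IsMesh X Y I K) : K * dx X I = Y := by
  have : (0 : ℝ) < K := by exact_mod_cast h.2.1
  rw [h.2.2]; field_simp

lemma IsMesh.node_x_mem (h : IsMesh X Y I K) (hX : 0 < X) (i : Fin (I + 1)) :
    (i : ℝ) * dx X I - X ∈ Icc (-X) X := by
  have h1 := h.dx_pos hX
  have h2 : ((i : ℕ) : ℝ) ≤ I := by exact_mod_cast Nat.lt_succ_iff.1 i.2
  have h3 := h.mul_dx
  have h4 := mul_le_mul_of_nonneg_right h2 h1.le
  have h5 : 0 ≤ ((i : ℕ) : ℝ) * dx X I := by positivity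
  constructor <;> linarith

lemma IsMesh.node_x_mem_Ioo (h : IsMesh X Y I K) (hX : 0 < X) {i : Fin (I + 1)} (hi0 : 0 < i.val)
    (hi : i.val < I) : (i : ℝ) * dx X I - X ∈ Ioo (-X) X := by
  have h1 := h.dx_pos hX
  have h2 : ((i : ℕ) : ℝ) < I := by exact_mod_cast hi
  have h2' : (0 : ℝ) < ((i : ℕ) : ℝ) := by exact_mod_cast hi0
  have h3 := h.mul_dx
  have h4 := mul_lt_mul_of_pos_right h2 h1
  have h5 : 0 < ((i : ℕ) : ℝ) * dx X I := by positivity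
  constructor <;> linarith

lemma IsMesh.node_y_mem (h : IsMesh X Y I K) (hX : 0 < X) (k : Fin (K + 1)) :
    (k : ℝ) * dx X I ∈ Icc 0 Y := by
  have h1 := h.dx_pos hX
  have h2 : ((k : ℕ) : ℝ) ≤ K := by exact_mod_cast Nat.lt_succ_iff.1 k.2
  have h3 := h.mul_dy
  have h4 := mul_le_mul_of_nonneg_right h2 h1.le
  exact ⟨by positivity, by linarith⟩

lemma IsMesh.node_y_mem_Ioo (h : IsMesh X Y I K) (hX : 0 < X) {k : Fin (K + 1)} (hk0 : 0 < k.val)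
    (hk : k.val < K) : (k : ℝ) * dx X I ∈ Ioo 0 Y := by
  have h1 := h.dx_pos hX
  have h2 : ((k : ℕ) : ℝ) < K := by exact_mod_cast hk
  have h2' : (0 : ℝ) < ((k : ℕ) : ℝ) := by exact_mod_cast hk0
  have h3 := h.mul_dy
  have h4 := mul_lt_mul_of_pos_right h2 h1
  exact ⟨by positivity, by linarith⟩

lemma IsMesh.dx_mem (h : IsMesh X Y I K) (hX : 0 < X) : dx X I ∈ Ioc 0 Y := by
  have h1 := h.dx_pos hX
  have h2 : (1 : ℝ) ≤ K := by exact_mod_cast h.2.1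
  have h3 := h.mul_dy
  exact ⟨h1, by nlinarith⟩

/-- The numeral `1` in `Fin (K + 1)` is taken modulo `K + 1`, so `K > 0` matters. -/
lemma IsMesh.val_one (h : IsMesh X Y I K) : ((1 : Fin (K + 1)) : ℕ) = 1 := by
  have := h.2.1
  rw [Fin.val_one']
  exact Nat.mod_eq_of_lt (by omega)

/-- Corners count as lateral, so the base formula of the scheme is needed only for `0 < i < I`. -/
lemma base_or_lateral_of_not_interior {i : Fin (I + 1)} {k : Fin (K + 1)}
    (h : ¬ IsInterior i k) : IsLateral i k ∨ (0 < i.val ∧ i.val < I ∧ k = 0) := by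
  unfold IsInterior at h
  unfold IsLateral
  have h1 := i.2
  have h2 := k.2
  by_cases hk : k.val = 0
  · have : k = 0 := Fin.ext hk
    by_cases h3 : 0 < i.val ∧ i.val < I
    · exact Or.inr ⟨h3.1, h3.2, this⟩
    · left; omega
  · left; omega

end Mesh

/-! ### Discrete stability and consistency in the interior. -/

/-- The discrete maximum principle bounds a grid function by its boundary values and by the discrete
operator. -/
lemma exists_discrete_bound {σ X Y a : ℝ} {L : Discretization} (h0 : 0 < σ) (hX : 0 < X)
    (hY : 0 < Y) (ha : 0 < a) (hmax : SatisfiesMaxPrinciple L X Y)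
    (horder : ∀ v : ℝ → ℝ → ℝ, ContDiff ℝ ∞ (fun p : ℝ × ℝ => v p.1 p.2) →
      HasOrderOn L σ X Y a {v}) :
    ∃ h₀ > 0, ∃ A : ℝ, 0 ≤ A ∧ ∀ I K : ℕ, IsMesh X Y I K → dx X I ≤ h₀ →
      ∀ (E : Grid I K) (c η : ℝ), 0 ≤ c → 0 ≤ η →
        (∀ i k, IsInterior i k → |L I K E i k| ≤ η) → (∀ i k, ¬ IsInterior i k → |E i k| ≤ c) →
        ∀ i k, |E i k| ≤ c + A * η := by
  obtain ⟨v, hv, c₀, hc₀, V, hvV, hvL⟩ := exists_barrier (X := X) h0 hY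
  obtain ⟨C, hC⟩ := horder v hv
  have hV0 : 0 ≤ V := by
    have := hvV 0 ⟨by linarith, hX.le⟩ 0 ⟨le_rfl, hY.le⟩
    linarith
  have hC1 : 0 < |C| + 1 := by positivity
  -- Below this mesh size the consistency error of the barrier is at most `c₀ / 2`, so its discrete
  -- image is at least `c₀ / 2`. Adding `2 * η / c₀` times the barrier compensates `η`, at a cost of
  -- at most `2 * V / c₀ * η`.
  refine ⟨(c₀ / 2 / (|C| + 1)) ^ (1 / a), by positivity, 2 * V / c₀, by positivity, ?_⟩
  intro I K hmesh hdx E c η hc hη hE hEb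
  have hh := hmesh.dx_pos hX
  have hsmall : C * dx X I ^ a ≤ c₀ / 2 := by
    have h1 := Real.rpow_le_rpow hh.le hdx ha.le
    rw [one_div, Real.rpow_inv_rpow (by positivity) ha.ne', le_div_iff₀ hC1] at h1
    have h2 : 0 < dx X I ^ a := Real.rpow_pos_of_pos hh _
    nlinarith [le_abs_self C]
  have hLv : ∀ i k, IsInterior i k → c₀ / 2 ≤ L I K (sample X I K v) i k := by
    intro i k hik
    have h1 := (abs_le.1 (hC I K hmesh v rfl i k hik)).1
    have h2 := hvL ((i : ℝ) * dx X I - X) _ (hmesh.node_y_mem_Ioo hX hik.2.2.1 hik.2.2.2)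
    linarith
  have hside : ∀ E : Grid I K, (∀ i k, IsInterior i k → -η ≤ L I K E i k) →
      (∀ i k, ¬ IsInterior i k → E i k ≤ c) → ∀ i k, E i k ≤ c + 2 * V / c₀ * η := by
    intro E hE hEb i k
    have hs0 : 0 ≤ 2 * η / c₀ := by positivity
    have hvs : ∀ i k, 0 ≤ sample X I K v i k ∧ sample X I K v i k ≤ V := fun i k =>
      hvV _ (hmesh.node_x_mem hX i) _ (hmesh.node_y_mem hX k)
    have h1 := hmax I K hmesh (E + (2 * η / c₀) • sample X I K v) (fun i k hik => by
      rw [map_add, map_smul]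
      simp only [Pi.add_apply, Pi.smul_apply, smul_eq_mul]
      have h2 := mul_le_mul_of_nonneg_left (hLv i k hik) hs0
      have h3 : 2 * η / c₀ * (c₀ / 2) = η := by field_simp
      linarith [hE i k hik]) (c + 2 * V / c₀ * η) (by positivity) (fun i k hik => by
      simp only [Pi.add_apply, Pi.smul_apply, smul_eq_mul]
      have h2 := mul_le_mul_of_nonneg_left (hvs i k).2 hs0
      have h3 : 2 * η / c₀ * V = 2 * V / c₀ * η := by ring
      linarith [hEb i k hik]) i k
    simp only [Pi.add_apply, Pi.smul_apply, smul_eq_mul] at h1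
    linarith [mul_nonneg hs0 (hvs i k).1]
  intro i k
  rw [abs_le']
  refine ⟨hside E (fun i k h => (abs_le.1 (hE i k h)).1) (fun i k h => (abs_le.1 (hEb i k h)).2) i k,
    hside (-E) (fun i k h => ?_) (fun i k h => ?_) i k⟩
  · rw [map_neg]
    simp only [Pi.neg_apply]
    linarith [(abs_le.1 (hE i k h)).2]
  · simp only [Pi.neg_apply]
    linarith [(abs_le.1 (hEb i k h)).1]

/-- The discrete operator of the exact solution is `O(Δx ^ a)`, also at the initial time. -/
lemma exists_consistency_bound {σ m X Y T a : ℝ} {f : ℝ → ℝ} {w : ℝ → ℝ → ℝ → ℝ}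
    {L : Discretization} (hw : IsClassicalSolution σ m X Y T f w) (hX : 0 < X) (hT : 0 < T)
    (horder_w : HasOrderOn L σ X Y a {v | ∃ t ∈ Ioc 0 T, v = fun x y => w x y t}) :
    ∃ C : ℝ, 0 ≤ C ∧ ∀ I K : ℕ, IsMesh X Y I K → ∀ t ∈ Icc 0 T, ∀ i k, IsInterior i k →
      |L I K (sample X I K fun x y => w x y t) i k| ≤ C * dx X I ^ a := by
  obtain ⟨C, hC⟩ := horder_w
  refine ⟨|C|, abs_nonneg C, fun I K hmesh t ht i k hik => ?_⟩
  have hh := hmesh.dx_pos hX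
  refine le_on_Icc_of_le_on_Ioc hT
    (φ := fun t => |L I K (sample X I K fun x y => w x y t) i k|)
    (ψ := fun _ => |C| * dx X I ^ a) ?_ continuousOn_const ?_ t ht
  · have hs : ContinuousOn (fun t => sample X I K fun x y => w x y t) (Icc 0 T) :=
      continuousOn_pi.2 fun i => continuousOn_pi.2 fun k =>
        hw.continuousOn_slice_time (hmesh.node_x_mem hX i) (hmesh.node_y_mem hX k)
    -- On a fixed grid a linear operator is continuous, so the bound passes to the limit `t → 0`.
    have hL : Continuous (L I K) := LinearMap.continuous_of_finiteDimensional _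
    have h1 : Continuous fun G : Grid I K => G i k := by fun_prop
    exact ((h1.comp hL).comp_continuousOn hs).abs
  · intro t ht
    have h1 := hC I K hmesh (fun x y => w x y t) ⟨t, ht, rfl⟩ i k hik
    rw [hw.extension_eq _ (hmesh.node_x_mem_Ioo hX hik.1 hik.2.1) _
      (hmesh.node_y_mem_Ioo hX hik.2.2.1 hik.2.2.2) t ht, sub_zero] at h1
    have h2 : 0 < dx X I ^ a := Real.rpow_pos_of_pos hh _
    exact h1.trans (mul_le_mul_of_nonneg_right (le_abs_self C) h2.le)

/-! ### The numerical solution: stability and the error on the boundary. -/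

section Scheme

variable {σ m X Y T M : ℝ} {f : ℝ → ℝ} {L : Discretization} {I K J : ℕ} {W : ℕ → Grid I K}

/-- The scheme in the variable `U = W ^ (1 / m)`. -/
lemma IsNumericalSolution.base_eq_step (hW : IsNumericalSolution L σ m X T f I K J W) (hm : 1 ≤ m)
    {j : ℕ} (hj : j < J) {i : Fin (I + 1)} (hi0 : 0 < i.val) (hi : i.val < I)
    (hpos : 0 ≤ W j i 0) :
    W (j + 1) i 0 = (W j i 0 ^ (1 / m) + nu σ * (dt T J / dx X I ^ σ) *
      (W j i 1 - (W j i 0 ^ (1 / m)) ^ m)) ^ m := by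
  rw [hW.base j hj i hi0 hi, rpow_rpow_one_div hm hpos, add_comm]

lemma rpow_one_div_mem {s : ℝ} (hm : 1 ≤ m) (hM : 0 ≤ M) (hs : s ∈ Icc 0 (M ^ m)) :
    s ^ (1 / m) ∈ Icc 0 M := by
  refine ⟨Real.rpow_nonneg hs.1 _, ?_⟩
  calc s ^ (1 / m) ≤ (M ^ m) ^ (1 / m) := Real.rpow_le_rpow hs.1 hs.2 (by positivity)
    _ = M := rpow_one_div_rpow hm hM

/-- Stability of the scheme. -/
lemma IsNumericalSolution.mem_Icc (hW : IsNumericalSolution L σ m X T f I K J W)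
    (hmax : SatisfiesMaxPrinciple L X Y) (hmesh : IsMesh X Y I K) (hX : 0 < X) (hm : 1 ≤ m)
    (hM : 0 ≤ M) (hf : ∀ x ∈ Icc (-X) X, f x ∈ Icc 0 M)
    (hl : 0 ≤ nu σ * (dt T J / dx X I ^ σ))
    (hlM : nu σ * (dt T J / dx X I ^ σ) * (m * M ^ (m - 1)) ≤ 1) :
    ∀ j ≤ J, ∀ i k, W j i k ∈ Icc 0 (M ^ m) := by
  have hm0 : 0 ≤ m := by linarith
  have hMm : 0 ≤ M ^ m := Real.rpow_nonneg hM _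
  -- Bounds on the base spread to all nodes by the discrete maximum principle, applied to `W j` and
  -- `-W j`.
  have hext : ∀ j ≤ J, (∀ i : Fin (I + 1), 0 < i.val → i.val < I → W j i 0 ∈ Icc 0 (M ^ m)) →
      ∀ i k, W j i k ∈ Icc 0 (M ^ m) := by
    intro j hj hbase
    have hbdry : ∀ i k, ¬ IsInterior i k → W j i k ∈ Icc 0 (M ^ m) := by
      intro i k hik
      rcases base_or_lateral_of_not_interior hik with h | ⟨h1, h2, rfl⟩
      · rw [hW.lateral j hj i k h]; exact ⟨le_rfl, hMm⟩
      · exact hbase i h1 h2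
    intro i k
    have hlow := hmax I K hmesh (-W j) (fun i k hik => by
      rw [map_neg, Pi.neg_apply, Pi.neg_apply, hW.interior j hj i k hik, neg_zero]) 0 le_rfl
      (fun i k hik => neg_nonpos.2 (hbdry i k hik).1) i k
    have hupp := hmax I K hmesh (W j) (fun i k hik => (hW.interior j hj i k hik).ge) (M ^ m) hMm
      (fun i k hik => (hbdry i k hik).2) i k
    exact ⟨neg_nonpos.1 hlow, hupp⟩
  intro j
  induction j with
  | zero =>
    intro hj
    refine hext 0 hj fun i hi0 hi => ?_
    have := hf _ (hmesh.node_x_mem hX i)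
    rw [hW.initial i hi0 hi]
    exact ⟨Real.rpow_nonneg this.1 _, Real.rpow_le_rpow this.1 this.2 hm0⟩
  | succ j ih =>
    intro hj
    have hprev := ih (by omega)
    refine hext (j + 1) hj fun i hi0 hi => ?_
    rw [hW.base_eq_step hm (by omega) hi0 hi (hprev i 0).1]
    have := step_mem hm hl hlM (rpow_one_div_mem hm hM (hprev i 0)) (hprev i 1)
    exact ⟨Real.rpow_nonneg this.1 _, Real.rpow_le_rpow this.1 this.2 hm0⟩

lemma le_errorF {w : ℝ → ℝ → ℝ → ℝ} (j : ℕ) (i : Fin (I + 1)) (k : Fin (K + 1)) :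
    |sample X I K (fun x y => w x y (j * dt T J)) i k - W j i k| ≤ errorF X T I K J w W j :=
  Finset.le_sup' (fun p : Fin (I + 1) × Fin (K + 1) =>
    |sample X I K (fun x y => w x y (j * dt T J)) p.1 p.2 - W j p.1 p.2|) (Finset.mem_univ (i, k))

lemma errorF_le {w : ℝ → ℝ → ℝ → ℝ} {j : ℕ} {c : ℝ}
    (h : ∀ i k, |sample X I K (fun x y => w x y (j * dt T J)) i k - W j i k| ≤ c) :
    errorF X T I K J w W j ≤ c :=
  Finset.sup'_le _ _ fun p _ => h p.1 p.2

lemma time_mem (hT : 0 < T) {j : ℕ} (hJ : 0 < J) (hj : j ≤ J) : (j : ℝ) * dt T J ∈ Icc 0 T := by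
  have h1 : (0 : ℝ) < J := by exact_mod_cast hJ
  have h2 : (j : ℝ) ≤ J := by exact_mod_cast hj
  have h3 : (J : ℝ) * dt T J = T := by unfold dt; field_simp
  have h4 : 0 < dt T J := by unfold dt; positivity
  exact ⟨by positivity, by nlinarith⟩

/-- The error vanishes on the lateral boundary and on the top. -/
lemma sample_sub_eq_zero_of_lateral {w : ℝ → ℝ → ℝ → ℝ}
    (hw : IsClassicalSolution σ m X Y T f w) (hW : IsNumericalSolution L σ m X T f I K J W)
    (hmesh : IsMesh X Y I K) (hX : 0 < X) (hY : 0 < Y) (hT : 0 < T) {j : ℕ} (hJ : 0 < J)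
    (hj : j ≤ J) {i : Fin (I + 1)} {k : Fin (K + 1)} (h : IsLateral i k) :
    sample X I K (fun x y => w x y (j * dt T J)) i k - W j i k = 0 := by
  have ht := time_mem hT hJ hj
  rw [hW.lateral j hj i k h, sub_zero]
  unfold sample
  rcases h with h | h | h
  · exact hw.lateral_corner hX hY (Or.inl (by rw [h]; simp)) (hmesh.node_y_mem hX k) ht
  · exact hw.lateral_corner hX hY (Or.inr (by rw [h, hmesh.mul_dx]; ring))
      (hmesh.node_y_mem hX k) ht
  · rw [h, hmesh.mul_dy]
    exact hw.top _ (hmesh.node_x_mem hX i) _ ht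

end Scheme

/-! ### The error recursion. -/

/-- The lower bounds on the time step make the interior consistency error negligible. -/
lemma rpow_dx_le {σ a D h τ : ℝ} (hh : 0 < h) (hτ : 0 < τ) (hD : 0 < D)
    (hstep : (σ ≤ 1 ∧ 2 * σ ≤ a ∧ D * h ^ (a / 2) ≤ τ) ∨
      (1 < σ ∧ 2 ≤ a ∧ D * h ^ (a + σ - 2) ≤ τ)) :
    h ^ a ≤ (1 / D ^ 2 + 1 / D) * (τ * (τ + h ^ (2 - σ))) := by
  have hp : 0 < h ^ (2 - σ) := Real.rpow_pos_of_pos hh _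
  have hDi : 0 < 1 / D := by positivity
  have hDi2 : 0 < 1 / D ^ 2 := by positivity
  have hττ : 0 < τ * τ := by positivity
  have hτp : 0 < τ * h ^ (2 - σ) := by positivity
  rcases hstep with ⟨-, -, h1⟩ | ⟨-, -, h1⟩
  · have h2 : h ^ (a / 2) ≤ τ / D := by rw [le_div_iff₀ hD]; linarith
    have h3 : h ^ a = h ^ (a / 2) * h ^ (a / 2) := by
      rw [← Real.rpow_add hh]; ring_nf
    have h4 : 0 < h ^ (a / 2) := Real.rpow_pos_of_pos hh _
    calc h ^ a ≤ τ / D * (τ / D) := by rw [h3]; gcongr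
      _ = 1 / D ^ 2 * (τ * τ) := by field_simp
      _ ≤ _ := by
        rw [mul_add τ]
        nlinarith [mul_pos hDi2 hτp, mul_pos hDi hττ, mul_pos hDi hτp]
  -- Here only one factor is traded for `τ`; the other, `h ^ (2 - σ)`, is already part of the rate.
  · have h2 : h ^ (a + σ - 2) ≤ τ / D := by rw [le_div_iff₀ hD]; linarith
    have h3 : h ^ a = h ^ (a + σ - 2) * h ^ (2 - σ) := by
      rw [← Real.rpow_add hh]; ring_nf
    calc h ^ a ≤ τ / D * h ^ (2 - σ) := by rw [h3]; gcongr
      _ = 1 / D * (τ * h ^ (2 - σ)) := by field_simp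
      _ ≤ _ := by
        rw [mul_add τ]
        nlinarith [mul_pos hDi2 hτp, mul_pos hDi hττ, mul_pos hDi2 hττ]

/-- Discrete Gronwall inequality over a time interval of length `T = J τ`. -/
lemma le_exp_mul_of_recursion {F : ℕ → ℝ} {k τ T δ P Q : ℝ} {J : ℕ} (hJ : 0 < J)
    (hJτ : J * τ = T) (hτ : 0 ≤ τ) (hk : 0 ≤ k) (hδ : 0 ≤ δ) (hP : 0 ≤ P) (hQ : 0 ≤ Q)
    (h0 : F 0 ≤ P * (τ * δ))
    (hF : ∀ j < J, F (j + 1) ≤ Real.exp (k * τ) * F j + Q * (τ * δ)) :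
    F J ≤ Real.exp (k * T) * ((P + Q) * T) * δ := by
  have hgron := le_of_recursion (Real.one_le_exp (by positivity : 0 ≤ k * τ))
    (by positivity) h0 hF J le_rfl
  have hexp : Real.exp (k * τ) ^ J = Real.exp (k * T) := by
    rw [← Real.exp_nat_mul]
    congr 1
    linear_combination k * hJτ
  have hτT : τ ≤ T := by
    have : (1 : ℝ) ≤ J := by exact_mod_cast hJ
    nlinarith
  rw [hexp] at hgron
  calc F J ≤ Real.exp (k * T) * (P * (τ * δ) + J * (Q * (τ * δ))) := hgron
    _ = Real.exp (k * T) * (P * (τ * δ) + Q * (T * δ)) := by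
        linear_combination Real.exp (k * T) * Q * δ * hJτ
    _ ≤ Real.exp (k * T) * (P * (T * δ) + Q * (T * δ)) := by gcongr
    _ = _ := by ring

/-- The error at a base node after one time step. -/
lemma base_error_step {σ m X Y T B C κ : ℝ} {f : ℝ → ℝ} {w : ℝ → ℝ → ℝ → ℝ}
    {L : Discretization} {I K J : ℕ} {W : ℕ → Grid I K}
    (hσ0 : 0 < σ) (hσ2 : σ < 2) (hm : 1 ≤ m) (hX : 0 < X) (hY : 0 < Y) (hT : 0 < T)
    (hf : ∀ x ∈ Icc (-X) X, 0 ≤ f x) (hw : IsClassicalSolution σ m X Y T f w)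
    (hreg : IsRegular σ m X Y T w)
    (hB : ∀ x ∈ Ioo (-X) X, ∀ t ∈ Icc 0 T,
      |iteratedDerivWithin 2 (trace m w x) (Icc 0 T) t| ≤ B)
    (hC : ∀ x ∈ Ioo (-X) X, ∀ t ∈ Icc 0 T, ∀ h ∈ Ioc 0 Y,
      |nu σ * ((w x h t - w x 0 t) / h ^ σ) - derivWithin (trace m w x) (Icc 0 T) t| ≤
        C * h ^ (2 - σ))
    (hκ0 : 0 ≤ κ)
    (hκ : ∀ x ∈ Ioo (-X) X, ∀ t ∈ Icc 0 T,
      m = 1 ∨ derivWithin (trace m w x) (Icc 0 T) t ≤ κ * trace m w x t)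
    (hmesh : IsMesh X Y I K) (hJ : 0 < J)
    (hlM : nu σ * (dt T J / dx X I ^ σ) * (m * supNorm X f ^ (m - 1)) ≤ 1)
    (hW : IsNumericalSolution L σ m X T f I K J W)
    {j : ℕ} (hj : j < J) (hmem : ∀ i k, W j i k ∈ Icc 0 (supNorm X f ^ m))
    {i : Fin (I + 1)} (hi0 : 0 < i.val) (hi : i.val < I) :
    |sample X I K (fun x y => w x y ((j + 1 : ℕ) * dt T J)) i 0 - W (j + 1) i 0| ≤
      (1 + κ * dt T J) ^ m * errorF X T I K J w W j +
        m * supNorm X f ^ (m - 1) *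
          (B * dt T J ^ 2 + C * (dt T J * dx X I ^ (2 - σ))) := by
  set h := dx X I with hh
  set τ := dt T J with hτ
  set M := supNorm X f with hM
  set x := (i : ℝ) * h - X with hxdef
  have hτ0 : 0 < τ := by
    have : (0 : ℝ) < J := by exact_mod_cast hJ
    rw [hτ]; unfold dt; positivity
  have hhY : h ∈ Ioc 0 Y := hmesh.dx_mem hX
  have hhσ : 0 < h ^ σ := Real.rpow_pos_of_pos hhY.1 _
  have hν := nu_pos hσ0 hσ2
  have hx : x ∈ Ioo (-X) X := hmesh.node_x_mem_Ioo hX hi0 hi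
  have hx' : x ∈ Icc (-X) X := ⟨hx.1.le, hx.2.le⟩
  have ht : (j : ℝ) * τ ∈ Icc 0 T := time_mem hT hJ hj.le
  have ht1 : ((j + 1 : ℕ) : ℝ) * τ ∈ Icc 0 T := time_mem hT hJ hj
  have ht1' : (j : ℝ) * τ + τ = ((j + 1 : ℕ) : ℝ) * τ := by push_cast; ring
  have hl : 0 ≤ nu σ * (τ / h ^ σ) := by positivity
  have hM0 : 0 ≤ M := (hf x hx').trans (hw.le_supNorm hm hY hT hf hx')
  have hs0 : ∀ t, sample X I K (fun x y => w x y t) i 0 = w x 0 t := by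
    intro t; simp [sample, hxdef, hh]
  have hs1 : ∀ t, sample X I K (fun x y => w x y t) i 1 = w x h t := by
    intro t
    simp only [sample, hmesh.val_one, Nat.cast_one, one_mul, hxdef, hh]
  set t := (j : ℝ) * τ with htdef
  set D := derivWithin (trace m w x) (Icc 0 T) t with hD
  have hwu : w x 0 t = trace m w x t ^ m := hw.w_eq_trace_rpow hm hY hx' ht
  have e0 := le_errorF (X := X) (T := T) (J := J) (w := w) (W := W) j i 0
  have e1 := le_errorF (X := X) (T := T) (J := J) (w := w) (W := W) j i 1
  rw [hs0, ← hτ, ← htdef, hwu, ← rpow_rpow_one_div hm (hmem i 0).1] at e0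
  rw [hs1, ← hτ, ← htdef] at e1
  rw [hs0, hw.w_eq_trace_rpow hm hY hx' ht1, hW.base_eq_step hm hj hi0 hi (hmem i 0).1]
  have hmemu : ∀ s ∈ Icc 0 T, trace m w x s ∈ Icc 0 M := fun s hs =>
    ⟨hw.trace_nonneg hY hx' hs, hw.trace_le_supNorm hσ0 hσ2 hm hX hY hT hf hx' hs⟩
  -- The shift is the first-order exact increment, with `κ * τ` as growth rate; the remaining goals
  -- are the bound on the shift, the Taylor remainder and the flux error.
  refine step_error (b := τ * D) hm hl hlM (rpow_one_div_mem hm hM0 (hmem i 0)) (hmem i 1)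
    (hmemu t ht) (hmemu _ ht1) (by positivity) ?_ e0 e1 ?_ ?_
  · refine (hκ x hx t ht).imp id fun h1 => ?_
    calc τ * D ≤ τ * (κ * trace m w x t) := by gcongr
      _ = _ := by ring
  · rw [← ht1']
    exact abs_taylor_le hT (hreg.contDiffOn_time x hx) (hB x hx) ht hτ0.le (ht1' ▸ ht1)
  · have h1 := hC x hx t ht h hhY
    rw [hwu] at h1
    have h2 : nu σ * (τ / h ^ σ) * (w x h t - trace m w x t ^ m) - τ * D =
        τ * (nu σ * ((w x h t - trace m w x t ^ m) / h ^ σ) - D) := by field_simp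
    rw [h2, abs_mul, abs_of_pos hτ0]
    calc _ ≤ τ * (C * h ^ (2 - σ)) := by gcongr
      _ = _ := by ring

end FracPME

/-! ### The convergence theorem. -/

theorem mainTheorem6 (σ m X Y T a D : ℝ) (f : ℝ → ℝ) (w : ℝ → ℝ → ℝ → ℝ)
    (L : FracPME.Discretization)
    (hσ0 : 0 < σ) (hσ2 : σ < 2) (hm : 1 ≤ m) (hX : 0 < X) (hY : 0 < Y) (hT : 0 < T)
    (hD : 0 < D)
    (hf : ∀ x ∈ Set.Icc (-X) X, 0 ≤ f x)
    (hw : FracPME.IsClassicalSolution σ m X Y T f w)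
    (hreg : FracPME.IsRegular σ m X Y T w)
    (hmax : FracPME.SatisfiesMaxPrinciple L X Y)
    (horder : ∀ v : ℝ → ℝ → ℝ, ContDiff ℝ ∞ (fun p : ℝ × ℝ => v p.1 p.2) →
      FracPME.HasOrderOn L σ X Y a {v})
    (horder_w : FracPME.HasOrderOn L σ X Y a
      {v | ∃ t ∈ Set.Ioc 0 T, v = fun x y => w x y t}) :
    ∃ C : ℝ, 0 < C ∧ ∀ I K J : ℕ, FracPME.IsMesh X Y I K → 0 < J →
      FracPME.StepRestriction σ m X T f I J →
      ((σ ≤ 1 ∧ 2 * σ ≤ a ∧ D * FracPME.dx X I ^ (a / 2) ≤ FracPME.dt T J) ∨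
        (1 < σ ∧ 2 ≤ a ∧ D * FracPME.dx X I ^ (a + σ - 2) ≤ FracPME.dt T J)) →
      ∀ W : ℕ → FracPME.Grid I K, FracPME.IsNumericalSolution L σ m X T f I K J W →
        FracPME.errorF X T I K J w W J ≤
          C * (FracPME.dt T J + FracPME.dx X I ^ (2 - σ)) := by
  open FracPME in
  rcases le_or_gt a 0 with ha | ha
  -- Both step conditions force `a > 0`, so here no mesh is admissible.
  · refine ⟨1, one_pos, fun I K J _ _ _ hstep => ?_⟩
    rcases hstep with h | h
    · linarith [h.2.1]
    · linarith [h.2.1]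
  obtain ⟨h₀, hh₀, A, hA0, hA⟩ := exists_discrete_bound hσ0 hX hY ha hmax horder
  obtain ⟨G, hG0, hG⟩ := exists_consistency_bound hw hX hT horder_w
  obtain ⟨B', hB'⟩ := hreg.bound_time
  obtain ⟨C, hC0, hC⟩ := hw.exists_flux_bound hreg hσ0 hσ2 hT
  obtain ⟨κ, hκ0, hκ⟩ := hw.exists_deriv_le hreg hσ0 hσ2 hm hY hT
  obtain ⟨N, hN⟩ := hw.exists_bound
  set M := supNorm X f with hMdef
  have hm0 : 0 ≤ m := by linarith
  have hfM : ∀ x ∈ Icc (-X) X, f x ∈ Icc 0 M := fun x hx =>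
    ⟨hf x hx, hw.le_supNorm hm hY hT hf hx⟩
  have hM0 : 0 ≤ M := (hfM 0 ⟨by linarith, hX.le⟩).1.trans (hfM 0 ⟨by linarith, hX.le⟩).2
  have hMm : 0 ≤ M ^ m := Real.rpow_nonneg hM0 _
  have hN0 : 0 ≤ N :=
    (hw.nonneg 0 ⟨by linarith, hX.le⟩ 0 ⟨le_rfl, hY.le⟩ 0 ⟨le_rfl, hT.le⟩).trans
      (hN 0 ⟨by linarith, hX.le⟩ 0 ⟨le_rfl, hY.le⟩ 0 ⟨le_rfl, hT.le⟩)
  set B := |B'| with hBdef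
  have hB0 : 0 ≤ B := abs_nonneg _
  have hB : ∀ x ∈ Ioo (-X) X, ∀ t ∈ Icc 0 T,
      |iteratedDerivWithin 2 (trace m w x) (Icc 0 T) t| ≤ B := fun x hx t ht =>
    (hB' x hx t ht).trans (le_abs_self B')
  set Λ := m * M ^ (m - 1) with hΛ
  have hΛ0 : 0 ≤ Λ := mul_nonneg hm0 (Real.rpow_nonneg hM0 _)
  set D₁ := 1 / D ^ 2 + 1 / D with hD₁
  have hD₁0 : 0 ≤ D₁ := by positivity
  set P := A * (G * D₁) with hP
  have hP0 : 0 ≤ P := by positivity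
  set Q := Λ * (B + C) + P with hQ
  have hQ0 : 0 ≤ Q := by positivity
  have hh₀σ : 0 < h₀ ^ (2 - σ) := Real.rpow_pos_of_pos hh₀ _
  -- `P` measures the interior consistency error in units of `Δt * δ`, `Q` the full defect of one
  -- step. `C₁` serves fine meshes, `C₂` coarse ones.
  set C₁ := Real.exp (κ * m * T) * ((P + Q) * T) with hC₁
  set C₂ := (N + M ^ m) / h₀ ^ (2 - σ) with hC₂
  have hC₁0 : 0 ≤ C₁ := by positivity
  have hC₂0 : 0 ≤ C₂ := by positivity
  refine ⟨C₁ + C₂ + 1, by positivity, fun I K J hmesh hJ hrestr hstep W hW => ?_⟩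
  have hh := hmesh.dx_pos hX
  have hJ0 : (0 : ℝ) < J := by exact_mod_cast hJ
  have hτ : 0 < dt T J := by unfold dt; positivity
  have hJτ : (J : ℝ) * dt T J = T := by unfold dt; field_simp
  have hστ : 0 < dx X I ^ (2 - σ) := Real.rpow_pos_of_pos hh _
  have hhσ : 0 < dx X I ^ σ := Real.rpow_pos_of_pos hh _
  set δ := dt T J + dx X I ^ (2 - σ) with hδ
  have hδ0 : 0 < δ := by positivity
  have hν := nu_pos hσ0 hσ2
  have hlM : nu σ * (dt T J / dx X I ^ σ) * (m * M ^ (m - 1)) ≤ 1 := by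
    have h1 : m * M ^ (m - 1) * nu σ * dt T J ≤ dx X I ^ σ := hrestr
    have h2 : nu σ * (dt T J / dx X I ^ σ) * (m * M ^ (m - 1)) =
        m * M ^ (m - 1) * nu σ * dt T J / dx X I ^ σ := by ring
    rw [h2]
    exact div_le_one_of_le₀ h1 hhσ.le
  have hmem := hW.mem_Icc hmax hmesh hX hm hM0 hfM (by positivity) hlM
  rcases lt_or_ge h₀ (dx X I) with hlarge | hsmall
  · -- on coarse meshes boundedness is enough
    have h1 : errorF X T I K J w W J ≤ N + M ^ m := by
      refine errorF_le fun i k => ?_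
      have e1 := hN _ (hmesh.node_x_mem hX i) _ (hmesh.node_y_mem hX k) _
        (time_mem hT hJ le_rfl)
      have e2 := hw.nonneg _ (hmesh.node_x_mem hX i) _ (hmesh.node_y_mem hX k) _
        (time_mem hT hJ le_rfl)
      have e3 := hmem J le_rfl i k
      unfold sample
      rw [abs_le]
      constructor <;> linarith [e3.1, e3.2]
    have h2 : N + M ^ m ≤ C₂ * δ := by
      have e1 : h₀ ^ (2 - σ) ≤ δ := by
        have := Real.rpow_le_rpow hh₀.le hlarge.le (by linarith : 0 ≤ 2 - σ)
        linarith
      calc N + M ^ m = C₂ * h₀ ^ (2 - σ) := by rw [hC₂]; field_simp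
        _ ≤ _ := by gcongr
    nlinarith
  · have hha := rpow_dx_le hh hτ hD hstep
    -- At every time level the error is controlled by its values on the base, up to one local
    -- defect.
    have hnode : ∀ j ≤ J, ∀ c, 0 ≤ c → (∀ i : Fin (I + 1), 0 < i.val → i.val < I →
        |sample X I K (fun x y => w x y (j * dt T J)) i 0 - W j i 0| ≤ c) →
        errorF X T I K J w W j ≤ c + P * (dt T J * δ) := by
      intro j hj c hc hbase
      have hGh : 0 ≤ G * dx X I ^ a := mul_nonneg hG0 (Real.rpow_nonneg hh.le _)
      refine errorF_le fun i k => ?_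
      refine (hA I K hmesh hsmall
        (sample X I K (fun x y => w x y (j * dt T J)) - W j) c (G * dx X I ^ a) hc hGh
        (fun i k hik => ?_) (fun i k hik => ?_) i k).trans ?_
      · rw [map_sub, Pi.sub_apply, Pi.sub_apply, hW.interior j hj i k hik, sub_zero]
        exact hG I K hmesh _ (time_mem hT hJ hj) i k hik
      · rw [Pi.sub_apply, Pi.sub_apply]
        rcases base_or_lateral_of_not_interior hik with h | ⟨h1, h2, rfl⟩
        · rw [sample_sub_eq_zero_of_lateral hw hW hmesh hX hY hT hJ hj h, abs_zero]
          exact hc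
        · exact hbase i h1 h2
      · have : P * (dt T J * δ) = A * (G * (D₁ * (dt T J * δ))) := by rw [hP]; ring
        rw [this]
        gcongr
    have hρ : (1 + κ * dt T J) ^ m ≤ Real.exp (κ * m * dt T J) := by
      have e1 : 1 + κ * dt T J ≤ Real.exp (κ * dt T J) := by
        linarith [Real.add_one_le_exp (κ * dt T J)]
      have e2 : κ * m * dt T J = κ * dt T J * m := by ring
      rw [e2, Real.exp_mul]
      exact Real.rpow_le_rpow (by positivity) e1 hm0
    have hF0 : ∀ j, 0 ≤ errorF X T I K J w W j := fun j =>
      (abs_nonneg _).trans (le_errorF (X := X) (T := T) (J := J) (w := w) (W := W) j 0 0)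
    -- The initial base values are exact; only the discrete extension contributes.
    have hinit : errorF X T I K J w W 0 ≤ P * (dt T J * δ) := by
      have := hnode 0 (Nat.zero_le J) 0 le_rfl fun i hi0 hi => ?_
      · rwa [zero_add] at this
      · rw [hW.initial i hi0 hi]
        have e1 : sample X I K (fun x y => w x y ((0 : ℕ) * dt T J)) i 0 =
            w (i * dx X I - X) 0 0 := by simp [sample]
        rw [e1, hw.initial _ (hmesh.node_x_mem hX i), sub_self, abs_zero]
    have hrec : ∀ j < J, errorF X T I K J w W (j + 1) ≤
        Real.exp (κ * m * dt T J) * errorF X T I K J w W j + Q * (dt T J * δ) := by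
      intro j hj
      have hstep1 := fun (i : Fin (I + 1)) (hi0 : 0 < i.val) (hi : i.val < I) =>
        base_error_step hσ0 hσ2 hm hX hY hT hf hw hreg hB hC hκ0 hκ hmesh hJ hlM hW hj
          (hmem j hj.le) hi0 hi
      have hF := hF0 j
      have e1 := hnode (j + 1) hj _ (by positivity) hstep1
      have e2 : (1 + κ * dt T J) ^ m * errorF X T I K J w W j ≤
          Real.exp (κ * m * dt T J) * errorF X T I K J w W j := by gcongr
      have e3 : B * dt T J ^ 2 + C * (dt T J * dx X I ^ (2 - σ)) ≤
          (B + C) * (dt T J * δ) := by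
        have f1 : 0 ≤ B * (dt T J * dx X I ^ (2 - σ)) := by positivity
        have f2 : 0 ≤ C * (dt T J * dt T J) := by positivity
        have f3 : (B + C) * (dt T J * δ) = B * dt T J ^ 2 + C * (dt T J * dx X I ^ (2 - σ)) +
            B * (dt T J * dx X I ^ (2 - σ)) + C * (dt T J * dt T J) := by rw [hδ]; ring
        linarith
      have e4 := mul_le_mul_of_nonneg_left e3 hΛ0
      have e5 : Q * (dt T J * δ) = Λ * ((B + C) * (dt T J * δ)) + P * (dt T J * δ) := by
        rw [hQ]; ring
      linarith
    have hgron := le_exp_mul_of_recursion hJ hJτ hτ.le (by positivity) hδ0.le hP0 hQ0 hinit hrec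
    calc errorF X T I K J w W J ≤ C₁ * δ := hgron
      _ ≤ (C₁ + C₂ + 1) * δ := by
          gcongr
          linarith
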